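/- Let $\lambda\ge 1$ and $n\ge 0$ be integers. Components of angular momentum $\lambda$ are indexed by $\mu=-\lambda,\dots,\lambda$ and refer to the real basis (real spherical harmonics) built from the standard basis $|\lambda m\rangle$, namely $|\lambda 0\rangle$, $\big((-1)^\mu|\lambda\mu\rangle+|\lambda\,{-\mu}\rangle\big)/\sqrt2$ for $\mu>0$, and $\mathrm{i}\big(|\lambda\mu\rangle-(-1)^\mu|\lambda\,{-\mu}\rangle\big)/\sqrt2$ for $\mu<0$; $D^\lambda$ denotes the Wigner $D$-matrix and $C^{\lambda\mu}_{l_1\mu_1l_2\mu_2}$ the Clebsch-Gordan coefficients (Condon-Shortley phases), both transformed to the real bases. For components $A$, $B$ of angular momenta $l_1$, $l_2$ put $$(A\,\widetilde\otimes\,B)_{l\mu}=\sum_{\mu_1,\mu_2}C^{l\mu}_{l_1\mu_1l_2\mu_2}A_{\mu_1}B_{\mu_2}.$$ A vector $a=(a_x,a_y,a_z)\in\mathbb R^3$ is regarded as an object of angular momentum $1$ with components $a_{-1}=a_y$, $a_0=a_z$, $a_1=a_x$. For $v_0,\dots,v_\lambda\in\mathbb R^3$ the pseudo-maximal coupling $$\big((v_0\,\widetilde\otimes\,v_1)_1\,\widetilde\otimes\,v_2\cdots\widetilde\otimes\,v_\lambda\big)_\lambda$$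 is obtained by contracting $v_0$ and $v_1$ to angular momentum $1$, and the result successively with $v_2,\dots,v_\lambda$ to the angular momenta $2,\dots,\lambda$. Let $\Theta_\lambda:(\mathbb R^3)^n\to\mathbb R^{2\lambda+1}$ be a harmonic pseudotensor, that is, an $O(3)$-equivariant function in the following sense: for every rotation $R$, with Euler angles $\alpha,\beta,\gamma$ in the $z$-$y$-$z$ convention, and all $r_1,\dots,r_n\in\mathbb R^3$, $$\Theta_{\lambda\mu}(Rr_1,\dots,Rr_n)=\sum_{\mu'}D^\lambda_{\mu\mu'}(\alpha,\beta,\gamma)\,\Theta_{\lambda\mu'}(r_1,\dots,r_n),\qquad \Theta_\lambda(-r_1,\dots,-r_n)=-(-1)^\lambda\,\Theta_\lambda(r_1,\dots,r_n).$$ Then there are real-valued functions $f_{i_0\ldots i_\lambda}$ on $(\mathbb R^3)^n$, invariant under $O(3)$, meaning $f_{i_0\ldots i_\lambda}(Qr_1,\dots,Qr_n)=f_{i_0\ldots i_\lambda}(r_1,\dots,r_n)$ for all $Q\in O(3)$, such that for all $r_1,\dots,r_n\in\mathbb R^3$ $$\Theta_\lambda(r_1,\dots,r_n)=\mathrm i\sum_{i_0>i_1}\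 \sum_{i_2\ge\cdots\ge i_\lambda}f_{i_0\ldots i_\lambda}(r_1,\dots,r_n)\,\big((r_{i_0}\,\widetilde\otimes\,r_{i_1})_1\,\widetilde\otimes\,r_{i_2}\cdots\widetilde\otimes\,r_{i_\lambda}\big)_\lambda ,$$ where all indices run over $\{1,\dots,n\}$. -/

import Mathlib

noncomputable section

/-- The `2 l + 1` magnetic indices `-l, …, l` of angular momentum `l`. -/
abbrev MagIdx (l : ℕ) : Type := {μ : ℤ // μ ∈ Finset.Icc (-(l : ℤ)) (l : ℤ)}

/-- The factorial of an integer (used for nonnegative arguments only). -/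
def intFact (z : ℤ) : ℝ := (Nat.factorial z.toNat : ℝ)

/-- The reciprocal factorial of an integer, with the usual convention `1 / z! = 0` for `z < 0`. -/
def invFact (z : ℤ) : ℝ := if 0 ≤ z then (intFact z)⁻¹ else 0

/-- The Clebsch-Gordan coefficient `⟨l₁ m₁ l₂ m₂ | l m⟩` of the standard (complex) spherical basis,
in the Condon-Shortley phase convention, by Racah's formula. -/
def clebschGordan (l₁ l₂ l : ℕ) (m₁ : MagIdx l₁) (m₂ : MagIdx l₂) (m : MagIdx l) : ℝ :=
  if m.1 = m₁.1 + m₂.1 ∧ l ≤ l₁ + l₂ ∧ l₁ ≤ l + l₂ ∧ l₂ ≤ l + l₁ then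
    Real.sqrt ((2 * (l : ℝ) + 1) * intFact ((l : ℤ) + l₁ - l₂) * intFact ((l : ℤ) - l₁ + l₂)
        * intFact ((l₁ : ℤ) + l₂ - l) / intFact ((l₁ : ℤ) + l₂ + l + 1))
      * Real.sqrt (intFact (l + m.1) * intFact (l - m.1) * intFact (l₁ - m₁.1)
        * intFact (l₁ + m₁.1) * intFact (l₂ - m₂.1) * intFact (l₂ + m₂.1))
      * ∑ k ∈ Finset.range (l₁ + l₂ + 1), (-1 : ℝ) ^ k * invFact k
        * invFact ((l₁ : ℤ) + l₂ - l - k) * invFact (l₁ - m₁.1 - k) * invFact (l₂ + m₂.1 - k)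
        * invFact ((l : ℤ) - l₂ + m₁.1 + k) * invFact ((l : ℤ) - l₁ - m₂.1 + k)
  else 0

/-- Wigner's (small) `d`-matrix `d^l_{m' m}(β)` in the standard spherical basis. -/
def wignerSmallD (l : ℕ) (β : ℝ) (m' m : MagIdx l) : ℝ :=
  Real.sqrt (intFact (l + m'.1) * intFact (l - m'.1) * intFact (l + m.1) * intFact (l - m.1))
    * ∑ s ∈ Finset.range (2 * l + 1), (-1 : ℝ) ^ (m'.1 - m.1 + s)
      * invFact (l + m.1 - s) * invFact s * invFact (m'.1 - m.1 + s) * invFact (l - m'.1 - s)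
      * Real.cos (β / 2) ^ (2 * (l : ℤ) + m.1 - m'.1 - 2 * s).toNat
      * Real.sin (β / 2) ^ (m'.1 - m.1 + 2 * s).toNat

/-- The Wigner `D`-matrix
`D^l_{m' m}(α, β, γ) = e^{-i m' α} d^l_{m' m}(β) e^{-i m γ}` in the standard spherical basis. -/
def wignerD (l : ℕ) (α β γ : ℝ) (m' m : MagIdx l) : ℂ :=
  Complex.exp (-Complex.I * (m'.1 : ℂ) * (α : ℂ)) * (wignerSmallD l β m' m : ℂ)
    * Complex.exp (-Complex.I * (m.1 : ℂ) * (γ : ℂ))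

/-- The coefficient of the standard basis vector `|l m⟩` in the real basis vector of index `μ`:
the real basis consists of `|l 0⟩`, of `((-1)^μ |l μ⟩ + |l -μ⟩) / √2` for `μ > 0`,
and of `i (|l μ⟩ - (-1)^μ |l -μ⟩) / √2` for `μ < 0` (real spherical harmonics). -/
def realBasis (l : ℕ) (μ m : MagIdx l) : ℂ :=
  if μ.1 = 0 then (if m.1 = 0 then 1 else 0)
  else if 0 < μ.1 then
    (if m.1 = μ.1 then (-1 : ℂ) ^ μ.1 / (Real.sqrt 2 : ℂ)
      else if m.1 = -μ.1 then 1 / (Real.sqrt 2 : ℂ) else 0)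
  else
    (if m.1 = μ.1 then Complex.I / (Real.sqrt 2 : ℂ)
      else if m.1 = -μ.1 then -(Complex.I * (-1 : ℂ) ^ μ.1) / (Real.sqrt 2 : ℂ) else 0)

/-- The Clebsch-Gordan coefficients `C^{l μ}_{l₁ μ₁ l₂ μ₂}` of the real bases. -/
def realCG (l₁ l₂ l : ℕ) (μ₁ : MagIdx l₁) (μ₂ : MagIdx l₂) (μ : MagIdx l) : ℂ :=
  ∑ m : MagIdx l, ∑ m₁ : MagIdx l₁, ∑ m₂ : MagIdx l₂,
    (starRingEnd ℂ) (realBasis l μ m) * (clebschGordan l₁ l₂ l m₁ m₂ m : ℂ)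
      * realBasis l₁ μ₁ m₁ * realBasis l₂ μ₂ m₂

/-- The Wigner `D`-matrix in the real basis (its entries are real numbers). -/
def realWignerD (l : ℕ) (α β γ : ℝ) (μ μ' : MagIdx l) : ℂ :=
  ∑ m : MagIdx l, ∑ m' : MagIdx l,
    (starRingEnd ℂ) (realBasis l μ m) * wignerD l α β γ m m' * realBasis l μ' m'

/-- The Clebsch-Gordan contraction of harmonic components of angular momenta `l₁` and `l₂`
to angular momentum `l`. -/
def cgContract (l₁ l₂ l : ℕ) (A : MagIdx l₁ → ℂ) (B : MagIdx l₂ → ℂ) (μ : MagIdx l) : ℂ :=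
  ∑ μ₁ : MagIdx l₁, ∑ μ₂ : MagIdx l₂, realCG l₁ l₂ l μ₁ μ₂ μ * (A μ₁ * B μ₂)

/-- A vector of `ℝ³`, with Cartesian components `(x, y, z)`, as an object of angular momentum `1`:
its components of index `-1, 0, 1` are `y, z, x`. -/
def vecHarm (a : Fin 3 → ℝ) (μ : MagIdx 1) : ℂ :=
  if μ.1 = -1 then (a 1 : ℂ) else if μ.1 = 0 then (a 2 : ℂ) else (a 0 : ℂ)

/-- The pseudo-maximal coupling of the `k + 2` vectors `v 0, …, v (k + 1)` to angular momentum
`k + 1`: `v 0` and `v 1` are contracted to angular momentum `1`, and the result is contracted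
successively with `v 2, …, v (k + 1)` to the angular momenta `2, …, k + 1`. -/
def pseudoMaximal : (k : ℕ) → (Fin (k + 2) → Fin 3 → ℝ) → MagIdx (k + 1) → ℂ
  | 0, v => cgContract 1 1 1 (vecHarm (v 0)) (vecHarm (v 1))
  | k + 1, v => cgContract (k + 1) 1 (k + 2)
      (pseudoMaximal k (fun j => v j.castSucc)) (vecHarm (v (Fin.last (k + 2))))

/-- The rotation of `ℝ³` by the angle `φ` about the `z` axis. -/
def rotZ (φ : ℝ) : Matrix (Fin 3) (Fin 3) ℝ :=
  !![Real.cos φ, -Real.sin φ, 0; Real.sin φ, Real.cos φ, 0; 0, 0, 1]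

/-- The rotation of `ℝ³` by the angle `φ` about the `y` axis. -/
def rotY (φ : ℝ) : Matrix (Fin 3) (Fin 3) ℝ :=
  !![Real.cos φ, 0, Real.sin φ; 0, 1, 0; -Real.sin φ, 0, Real.cos φ]

/-- The rotation of `ℝ³` with Euler angles `α, β, γ` (`z`-`y`-`z` convention). -/
def eulerRot (α β γ : ℝ) : Matrix (Fin 3) (Fin 3) ℝ := rotZ α * rotY β * rotZ γ

/-- `Θ` is an `O(3)`-equivariant harmonic pseudotensor of angular momentum `l` of `n` vectors:
its components transform under rotations with the real Wigner `D`-matrix, and acquire the sign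
`-(-1)^l` under the inversion. As `O(3)` consists of the rotations and of their products with the
inversion, and every rotation has Euler angles, this is equivariance under `O(3)`. -/
structure IsHarmonicPseudotensor (l n : ℕ) (Θ : (Fin n → Fin 3 → ℝ) → MagIdx l → ℝ) : Prop where
  rotation : ∀ (α β γ : ℝ) (r : Fin n → Fin 3 → ℝ) (μ : MagIdx l),
    (Θ (fun i => (eulerRot α β γ).mulVec (r i)) μ : ℂ)
      = ∑ μ' : MagIdx l, realWignerD l α β γ μ μ' * (Θ r μ' : ℂ)
  inversion : ∀ (r : Fin n → Fin 3 → ℝ) (μ : MagIdx l),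
    Θ (fun i => -r i) μ = -(-1 : ℝ) ^ l * Θ r μ

/-- `f` is a real scalar function of `n` vectors: it is invariant under `O(3)`. -/
def IsScalarFunction (n : ℕ) (f : (Fin n → Fin 3 → ℝ) → ℝ) : Prop :=
  ∀ Q ∈ Matrix.orthogonalGroup (Fin 3) ℝ, ∀ r : Fin n → Fin 3 → ℝ,
    f (fun i => Q.mulVec (r i)) = f r

/-- The index tuples `(i₀, …, i_{k+1})` with `i₀ > i₁` and `i₂ ≥ … ≥ i_{k+1}`. -/
def orderedTuples (n k : ℕ) : Finset (Fin (k + 2) → Fin n) :=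
  {i | i 1 < i 0 ∧ ∀ a b : Fin (k + 2), 2 ≤ a.1 → a ≤ b → i b ≤ i a}

end

/-! A vector of angular momentum `l` is encoded as a binary form of degree `2 l` in two spinor
variables `u, v` (`harmForm`, injective). In this picture the Wigner matrices act by substitution
(`harmForm_realWignerD`), coupling to maximal angular momentum is multiplication of forms up to a
positive constant (`harmForm_cgContract_max`), and coupling two vectors to angular momentum `1` is
the cross product up to an imaginary constant. Hence a pseudo-maximal coupling is `i c` times the
quadratic form of `v₀ × v₁` times those of the remaining vectors (`harmForm_pseudoMaximal`).

The problem is then pointwise. The set of real coefficient families that expand `Θ r` is constant on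
`O(3)`-orbits (`couplingCoeffs_mulVec`), so a choice depending only on this set gives invariant
functions; it remains to see that the set is nonempty. If all vectors are collinear, they can be
rotated to the `z` axis, where equivariance forces `Θ = 0`. Otherwise some nonzero cross product is
rotated to the `z` axis, so the vectors span at least the `xy`-plane. If they span all of space,
products of the available quadratic forms give every monomial. If they are coplanar, the half turn
about `z` coincides with the inversion, and only monomials odd in both `u` and `v` survive; these
are `uv` (the normal) times powers of `u²` and `v²` (the plane). Complex coefficients can be made
real because `i` times each coupling is real (`conj_pseudoMaximal`). -/

/-! ### Real and standard components. -/

theorem sum_magIdx {M : Type*} [AddCommMonoid M] (l : ℕ) (f : ℤ → M) :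
    ∑ m : MagIdx l, f m.1 = ∑ a ∈ Finset.range (2 * l + 1), f ((a : ℤ) - l) := by
  rw [Finset.sum_coe_sort (Finset.Icc (-(l : ℤ)) l) f]
  symm
  refine Finset.sum_nbij' (fun a => (a : ℤ) - l) (fun m => (m + l).toNat) ?_ ?_ ?_ ?_ ?_ <;>
    simp <;> intros <;> omega
theorem conj_real_sqrt_two : (starRingEnd ℂ) (Real.sqrt 2 : ℂ) = Real.sqrt 2 :=
  Complex.conj_ofReal _
theorem sum_magIdx_one {M : Type*} [AddCommMonoid M] (f : MagIdx 1 → M) :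
    ∑ m : MagIdx 1, f m = f ⟨-1, by simp⟩ + f ⟨0, by simp⟩ + f ⟨1, by simp⟩ := by
  rw [show (Finset.univ : Finset (MagIdx 1)) = {⟨-1, by simp⟩, ⟨0, by simp⟩, ⟨1, by simp⟩}
    by decide]
  simp [add_assoc]
/-- The index of opposite sign. -/
def MagIdx.neg {l : ℕ} (m : MagIdx l) : MagIdx l :=
  ⟨-m.1, by have := Finset.mem_Icc.1 m.2; exact Finset.mem_Icc.2 (by omega)⟩

theorem MagIdx.neg_neg {l : ℕ} (m : MagIdx l) : m.neg.neg = m := Subtype.ext (_root_.neg_neg _)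

theorem sum_magIdx_neg {M : Type*} [AddCommMonoid M] (l : ℕ) (f : MagIdx l → M) :
    ∑ m : MagIdx l, f m.neg = ∑ m : MagIdx l, f m :=
  Finset.sum_nbij' MagIdx.neg MagIdx.neg (by simp) (by simp)
    (fun m _ => m.neg_neg) (fun m _ => m.neg_neg) (fun _ _ => rfl)

theorem neg_one_zpow_mul_self (z : ℤ) : (-1 : ℂ) ^ z * (-1 : ℂ) ^ z = 1 := by
  rw [← mul_zpow]; simp

theorem conj_neg_one_zpow (z : ℤ) : (starRingEnd ℂ) ((-1 : ℂ) ^ z) = (-1 : ℂ) ^ z := by simp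

theorem neg_one_zpow_neg (z : ℤ) : (-1 : ℂ) ^ (-z) = (-1 : ℂ) ^ z := by
  rw [zpow_neg, inv_eq_iff_eq_inv, ← one_div, eq_div_iff (by simp [zpow_ne_zero]),
    neg_one_zpow_mul_self]

/-- This is what makes the basis real: its vectors are fixed by the antilinear map `|m⟩ ↦ (-1)^m
|-m⟩`. It serves both unitarity and the reality of the couplings. -/
theorem realBasis_neg (l : ℕ) (μ m : MagIdx l) :
    realBasis l μ m.neg = (-1 : ℂ) ^ m.1 * (starRingEnd ℂ) (realBasis l μ m) := by
  have h := neg_one_zpow_mul_self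
  have hc := conj_neg_one_zpow
  have hn := neg_one_zpow_neg
  unfold realBasis MagIdx.neg
  dsimp only
  by_cases h0 : μ.1 = 0
  · by_cases hm : m.1 = 0 <;> simp [h0, hm]
  by_cases hp : 0 < μ.1
  · rw [if_neg h0, if_pos hp, if_neg h0, if_pos hp]
    by_cases h1 : m.1 = μ.1
    · have : -m.1 ≠ μ.1 := by omega
      have h2 : -m.1 = -μ.1 := by omega
      rw [if_neg this, if_pos h2, if_pos h1, map_div₀, hc, conj_real_sqrt_two, h1,
        ← mul_div_assoc, h]
    · by_cases h2 : m.1 = -μ.1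
      · have h3 : -m.1 = μ.1 := by omega
        rw [if_pos h3, if_neg h1, if_pos h2, map_div₀, conj_real_sqrt_two, h2, hn]
        simp [div_eq_mul_inv]
      · have h3 : -m.1 ≠ μ.1 := by omega
        have h4 : -m.1 ≠ -μ.1 := by omega
        simp [h1, h2, h3, h4]
  · rw [if_neg h0, if_neg hp, if_neg h0, if_neg hp]
    by_cases h1 : m.1 = μ.1
    · have : -m.1 ≠ μ.1 := by omega
      have h2 : -m.1 = -μ.1 := by omega
      rw [if_neg this, if_pos h2, if_pos h1, map_div₀, conj_real_sqrt_two, h1, Complex.conj_I]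
      ring
    · by_cases h2 : m.1 = -μ.1
      · have h3 : -m.1 = μ.1 := by omega
        rw [if_pos h3, if_neg h1, if_pos h2, map_div₀, conj_real_sqrt_two, h2, hn]
        simp only [map_neg, map_mul, hc, Complex.conj_I]
        linear_combination (-Complex.I / (Real.sqrt 2 : ℂ)) * h μ.1
      · have h3 : -m.1 ≠ μ.1 := by omega
        have h4 : -m.1 ≠ -μ.1 := by omega
        simp [h1, h2, h3, h4]

theorem realBasis_eq_zero {l : ℕ} {μ m : MagIdx l} (h₁ : m ≠ μ) (h₂ : m ≠ μ.neg) :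
    realBasis l μ m = 0 := by
  have h1 : m.1 ≠ μ.1 := fun h => h₁ (Subtype.ext h)
  have h2 : m.1 ≠ -μ.1 := fun h => h₂ (Subtype.ext h)
  unfold realBasis
  split_ifs <;> first | rfl | omega

theorem MagIdx.val_neg {l : ℕ} (m : MagIdx l) : m.neg.1 = -m.1 := rfl

theorem inv_sqrt_two_mul_self : (Real.sqrt 2 : ℂ)⁻¹ * (Real.sqrt 2 : ℂ)⁻¹ = 1 / 2 := by
  rw [← mul_inv, ← Complex.ofReal_mul, Real.mul_self_sqrt (by norm_num)]; norm_num

theorem realBasis_self_of_pos {l : ℕ} {μ : MagIdx l} (h : 0 < μ.1) :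
    realBasis l μ μ = (-1 : ℂ) ^ μ.1 * (Real.sqrt 2 : ℂ)⁻¹ := by
  simp [realBasis, h, h.ne', div_eq_mul_inv]

theorem realBasis_self_of_neg {l : ℕ} {μ : MagIdx l} (h : μ.1 < 0) :
    realBasis l μ μ = Complex.I * (Real.sqrt 2 : ℂ)⁻¹ := by
  simp [realBasis, h.not_gt, h.ne, div_eq_mul_inv]

/-- The change of basis between the real and the standard basis, as a matrix. -/
noncomputable def realBasisMatrix (l : ℕ) : Matrix (MagIdx l) (MagIdx l) ℂ :=
  Matrix.of (realBasis l)

open scoped Matrix in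
-- Row `μ` is supported on `±μ`, and by `realBasis_neg` the term at `-μ` is the conjugate of the
-- term at `μ`, so only one real part has to be computed.
theorem realBasisMatrix_mul_conjTranspose (l : ℕ) :
    realBasisMatrix l * (realBasisMatrix l)ᴴ = 1 := by
  have hs := inv_sqrt_two_mul_self
  have hI := Complex.I_mul_I
  ext μ ν
  rw [Matrix.mul_apply]
  simp only [Matrix.conjTranspose_apply, realBasisMatrix, Matrix.of_apply, RCLike.star_def]
  by_cases h0 : μ.1 = 0
  · rw [Finset.sum_eq_single μ]
    · by_cases hν : μ = ν
      · subst hν; simp [realBasis, h0]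
      · have : μ.1 ≠ ν.1 := fun h => hν (Subtype.ext h)
        rw [Matrix.one_apply_ne hν, realBasis_eq_zero hν, map_zero, mul_zero]
        intro hh
        have := congrArg Subtype.val hh
        simp only [MagIdx.neg] at this
        omega
    · intro m _ hm
      rw [realBasis_eq_zero hm, zero_mul]
      intro hh; apply hm; rw [hh]; exact Subtype.ext (by simp [MagIdx.neg, h0])
    · simp
  · have hne : μ ≠ μ.neg := fun hh => by
      have := congrArg Subtype.val hh
      simp only [MagIdx.neg] at this
      omega
    rw [← Finset.sum_subset (Finset.subset_univ {μ, μ.neg}), Finset.sum_pair hne]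
    · rw [realBasis_neg, realBasis_neg]
      simp only [map_mul, conj_neg_one_zpow, Complex.conj_conj]
      have h := neg_one_zpow_mul_self μ.1
      suffices realBasis l μ μ * (starRingEnd ℂ) (realBasis l ν μ)
          + (starRingEnd ℂ) (realBasis l μ μ) * realBasis l ν μ = (1 : Matrix _ _ ℂ) μ ν by
        linear_combination this + (starRingEnd ℂ) (realBasis l μ μ) * realBasis l ν μ * h
      by_cases hν : μ = ν
      · subst hν
        rw [Matrix.one_apply_eq]
        rcases lt_or_gt_of_ne h0 with hp | hp
        · rw [realBasis_self_of_neg hp]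
          simp only [map_mul, map_inv₀, conj_real_sqrt_two, Complex.conj_I]
          linear_combination 2 * hs - 2 * (Real.sqrt 2 : ℂ)⁻¹ * (Real.sqrt 2 : ℂ)⁻¹ * hI
        · rw [realBasis_self_of_pos hp]
          simp only [map_mul, map_inv₀, conj_real_sqrt_two, conj_neg_one_zpow]
          linear_combination 2 * hs + 2 * (Real.sqrt 2 : ℂ)⁻¹ * (Real.sqrt 2 : ℂ)⁻¹ * h
      · rw [Matrix.one_apply_ne hν]
        by_cases hν' : μ = ν.neg
        · rw [show realBasis l ν μ = realBasis l ν ν.neg by rw [← hν'], realBasis_neg]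
          have hv : μ.1 = -ν.1 := by rw [hν', MagIdx.val_neg]
          rcases lt_or_gt_of_ne h0 with hp | hp
          · rw [realBasis_self_of_neg hp, realBasis_self_of_pos (by omega)]
            simp only [map_mul, map_inv₀, conj_real_sqrt_two, conj_neg_one_zpow, Complex.conj_I]
            ring
          · rw [realBasis_self_of_pos hp, realBasis_self_of_neg (by omega)]
            simp only [map_mul, map_inv₀, conj_real_sqrt_two, conj_neg_one_zpow, Complex.conj_I,
              map_neg]
            ring
        · rw [realBasis_eq_zero hν hν']; simp
    · intro m _ hm
      simp only [Finset.mem_insert, Finset.mem_singleton, not_or] at hm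
      rw [realBasis_eq_zero hm.1 hm.2, zero_mul]

/-- The components in the standard basis of the vector with given components in the real basis. -/
noncomputable def toStandard (l : ℕ) : (MagIdx l → ℂ) →ₗ[ℂ] (MagIdx l → ℂ) :=
  (realBasisMatrix l).vecMulLinear

theorem toStandard_apply (l : ℕ) (A : MagIdx l → ℂ) (m : MagIdx l) :
    toStandard l A m = ∑ μ, A μ * realBasis l μ m := rfl

open scoped Matrix in
theorem toStandard_injective (l : ℕ) : Function.Injective (toStandard l) := by
  intro A B h
  have h' : A ᵥ* realBasisMatrix l = B ᵥ* realBasisMatrix l := h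
  have := congrArg (· ᵥ* (realBasisMatrix l)ᴴ) h'
  simpa [Matrix.vecMul_vecMul, realBasisMatrix_mul_conjTranspose] using this

open scoped Matrix in
theorem toStandard_sum_conj (l : ℕ) (B : MagIdx l → ℂ) :
    toStandard l (fun μ => ∑ m, (starRingEnd ℂ) (realBasis l μ m) * B m) = B := by
  have h : (fun μ => ∑ m, (starRingEnd ℂ) (realBasis l μ m) * B m)
      = B ᵥ* (realBasisMatrix l)ᴴ := by
    ext μ
    simp [Matrix.vecMul, dotProduct, realBasisMatrix, mul_comm]
  rw [h]
  change (B ᵥ* (realBasisMatrix l)ᴴ) ᵥ* realBasisMatrix l = B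
  rw [Matrix.vecMul_vecMul, mul_eq_one_comm.1 (realBasisMatrix_mul_conjTranspose l),
    Matrix.vecMul_one]

theorem toStandard_conj (l : ℕ) (A : MagIdx l → ℂ) (m : MagIdx l) :
    toStandard l (fun μ => (starRingEnd ℂ) (A μ)) m
      = (-1) ^ m.1 * (starRingEnd ℂ) (toStandard l A m.neg) := by
  simp only [toStandard_apply, map_sum, map_mul, Finset.mul_sum]
  refine Finset.sum_congr rfl fun μ _ => ?_
  rw [realBasis_neg, map_mul, conj_neg_one_zpow, Complex.conj_conj]
  linear_combination (-(starRingEnd ℂ) (A μ) * realBasis l μ m) * neg_one_zpow_mul_self m.1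

/-- By unitarity the conjugated basis factor in `realCG` cancels, so the rest of the proof can use
Racah's formula directly. -/
theorem toStandard_cgContract (l₁ l₂ l : ℕ) (A : MagIdx l₁ → ℂ) (B : MagIdx l₂ → ℂ)
    (m : MagIdx l) :
    toStandard l (cgContract l₁ l₂ l A B) m
      = ∑ m₁, ∑ m₂, (clebschGordan l₁ l₂ l m₁ m₂ m : ℂ)
          * (toStandard l₁ A m₁ * toStandard l₂ B m₂) := by
  have h : cgContract l₁ l₂ l A B = fun μ => ∑ m, (starRingEnd ℂ) (realBasis l μ m) *
      ∑ m₁, ∑ m₂, (clebschGordan l₁ l₂ l m₁ m₂ m : ℂ)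
          * (toStandard l₁ A m₁ * toStandard l₂ B m₂) := by
    ext μ
    calc cgContract l₁ l₂ l A B μ
        = ∑ p : MagIdx l₁ × MagIdx l₂, ∑ q : MagIdx l × MagIdx l₁ × MagIdx l₂,
          (starRingEnd ℂ) (realBasis l μ q.1) * (clebschGordan l₁ l₂ l q.2.1 q.2.2 q.1 : ℂ)
            * realBasis l₁ p.1 q.2.1 * realBasis l₂ p.2 q.2.2 * (A p.1 * B p.2) := by
          simp only [cgContract, realCG, Finset.sum_mul, Fintype.sum_prod_type]
      _ = _ := Finset.sum_comm
      _ = _ := by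
          simp only [Fintype.sum_prod_type, toStandard_apply, Finset.sum_mul_sum]
          simp only [Finset.mul_sum]
          refine Finset.sum_congr rfl fun m _ => Finset.sum_congr rfl fun m₁ _ =>
            Finset.sum_congr rfl fun m₂ _ => Finset.sum_congr rfl fun μ₁ _ =>
            Finset.sum_congr rfl fun μ₂ _ => ?_
          ring
  rw [h, toStandard_sum_conj]

theorem toStandard_realWignerD (l : ℕ) (α β γ : ℝ) (A : MagIdx l → ℂ) (m : MagIdx l) :
    toStandard l (fun μ => ∑ μ', realWignerD l α β γ μ μ' * A μ') m
      = ∑ m', wignerD l α β γ m m' * toStandard l A m' := by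
  have h : (fun μ => ∑ μ', realWignerD l α β γ μ μ' * A μ') = fun μ => ∑ m,
      (starRingEnd ℂ) (realBasis l μ m) * ∑ m', wignerD l α β γ m m' * toStandard l A m' := by
    ext μ
    simp only [realWignerD, toStandard_apply, Finset.mul_sum, Finset.sum_mul]
    rw [Finset.sum_comm]
    refine Finset.sum_congr rfl fun m _ => ?_
    rw [Finset.sum_comm]
    refine Finset.sum_congr rfl fun m' _ => Finset.sum_congr rfl fun μ' _ => ?_
    ring
  rw [h, toStandard_sum_conj]

/-! ### Binary forms and Wigner matrices as substitutions. -/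

theorem invFact_natCast (n : ℕ) : invFact (n : ℤ) = (n.factorial : ℝ)⁻¹ := by
  simp [invFact, intFact]

theorem invFact_of_neg {z : ℤ} (h : z < 0) : invFact z = 0 := by
  simp [invFact, h.not_ge]

theorem intFact_pos (z : ℤ) : 0 < intFact z := by
  unfold intFact; exact_mod_cast Nat.factorial_pos _

theorem intFact_natCast (n : ℕ) : intFact (n : ℤ) = n.factorial := by simp [intFact]

theorem factorial_mul_inv_eq_choose {p k : ℕ} (h : k ≤ p) :
    (p.factorial : ℂ) * (((p - k).factorial : ℂ)⁻¹ * (k.factorial : ℂ)⁻¹) = p.choose k := by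
  rw [Nat.cast_choose ℂ h, ← mul_inv, div_eq_mul_inv, mul_comm ((p - k).factorial : ℂ)]

/-- Expand both binomials: with `k` factors `s v` from the first and `j` factors `-s u` from the
second, the exponent of `u` is `a = p - k + j`. The convention `1 / z! = 0` for `z < 0` removes the
pairs `(a, k)` that do not arise. -/
theorem sum_factorial_eq_mul_pow (p q : ℕ) (c s u v : ℂ) :
    (p.factorial * q.factorial : ℂ) * ∑ a ∈ Finset.range (p + q + 1),
      ∑ k ∈ Finset.range (p + q + 1), (-1 : ℂ) ^ ((a : ℤ) - p + k)
        * (invFact ((p : ℤ) - k) : ℂ) * (invFact (k : ℤ) : ℂ)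
        * (invFact ((a : ℤ) - p + k) : ℂ) * (invFact ((p : ℤ) + q - a - k) : ℂ)
        * c ^ ((p : ℤ) + q + p - a - 2 * k).toNat * s ^ ((a : ℤ) - p + 2 * k).toNat
        * (u ^ a * v ^ (p + q - a))
      = (c * u + s * v) ^ p * (c * v - s * u) ^ q := by
  rw [add_comm (c * u), sub_eq_neg_add, add_pow, add_pow, Finset.sum_mul_sum, ← Finset.sum_product',
    ← Finset.sum_product', Finset.mul_sum]
  symm
  refine Finset.sum_of_injOn (fun x => (p - x.1 + x.2, x.1)) ?_ ?_ ?_ ?_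
  · rintro ⟨k, j⟩ h ⟨k', j'⟩ h' hh
    simp only [Prod.mk.injEq] at hh ⊢
    omega
  · rintro ⟨k, j⟩ h
    simp only [Finset.coe_product, Set.mem_prod, Finset.coe_range, Set.mem_Iio] at h ⊢
    omega
  · rintro ⟨a, k⟩ h hn
    simp only [Finset.mem_product, Finset.mem_range] at h
    by_cases h1 : p < k
    · rw [invFact_of_neg (z := (p : ℤ) - k) (by omega)]; simp
    by_cases h2 : a + k < p
    · rw [invFact_of_neg (z := (a : ℤ) - p + k) (by omega)]; simp
    by_cases h3 : p + q < a + k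
    · rw [invFact_of_neg (z := (p : ℤ) + q - a - k) (by omega)]; simp
    · refine absurd ⟨(k, a + k - p), ?_, ?_⟩ hn
      · simp only [Finset.coe_product, Set.mem_prod, Finset.coe_range, Set.mem_Iio]; omega
      · exact Prod.ext (by dsimp only; omega) rfl
  · rintro ⟨k, j⟩ h
    simp only [Finset.mem_product, Finset.mem_range] at h ⊢
    have e1 : (((p - k + j : ℕ) : ℤ) - p + k) = (j : ℤ) := by omega
    have e2 : ((p : ℤ) - k) = ((p - k : ℕ) : ℤ) := by omega
    have e3 : ((p : ℤ) + q - (p - k + j : ℕ) - k) = ((q - j : ℕ) : ℤ) := by omega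
    have e4 : ((p : ℤ) + q + p - (p - k + j : ℕ) - 2 * k).toNat = (p - k) + (q - j) := by omega
    have e5 : (((p - k + j : ℕ) : ℤ) - p + 2 * k).toNat = k + j := by omega
    have e6 : p + q - (p - k + j) = k + (q - j) := by omega
    rw [e1, e2, e3, e4, e5, e6, invFact_natCast, invFact_natCast, invFact_natCast, invFact_natCast,
      ← factorial_mul_inv_eq_choose (show k ≤ p by omega),
      ← factorial_mul_inv_eq_choose (show j ≤ q by omega)]
    push_cast
    rw [zpow_natCast, neg_pow (s * u) j]
    ring

/-- The norm of the monomial `u ^ (l + m) * v ^ (l - m)`. -/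
noncomputable def spinorNorm (l : ℕ) (m : MagIdx l) : ℝ :=
  Real.sqrt (intFact (l + m.1) * intFact (l - m.1))

theorem spinorNorm_pos (l : ℕ) (m : MagIdx l) : 0 < spinorNorm l m :=
  Real.sqrt_pos.2 (mul_pos (intFact_pos _) (intFact_pos _))

theorem spinorNorm_ne_zero (l : ℕ) (m : MagIdx l) : (spinorNorm l m : ℂ) ≠ 0 := by
  exact_mod_cast (spinorNorm_pos l m).ne'

theorem spinorNorm_mul_self (l : ℕ) (m : MagIdx l) :
    spinorNorm l m * spinorNorm l m = intFact (l + m.1) * intFact (l - m.1) :=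
  Real.mul_self_sqrt (mul_pos (intFact_pos _) (intFact_pos _)).le

theorem spinorNorm_neg (l : ℕ) (m : MagIdx l) : spinorNorm l m.neg = spinorNorm l m := by
  unfold spinorNorm
  rw [MagIdx.val_neg, sub_neg_eq_add, ← sub_eq_add_neg, mul_comm]

/-- The normalized monomial in two spinor variables that represents `|l m⟩`. -/
noncomputable def spinorMonomial (l : ℕ) (m : MagIdx l) (z : ℂ × ℂ) : ℂ :=
  z.1 ^ (l + m.1).toNat * z.2 ^ (l - m.1).toNat / spinorNorm l m

/-- The binary form of degree `2 l` that represents a vector of angular momentum `l`,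
given by its components in the standard basis. -/
noncomputable def spinorForm (l : ℕ) : (MagIdx l → ℂ) →ₗ[ℂ] (ℂ × ℂ → ℂ) where
  toFun A := fun z => ∑ m, A m * spinorMonomial l m z
  map_add' A B := by ext z; simp [add_mul, Finset.sum_add_distrib]
  map_smul' a A := by ext z; simp [Finset.mul_sum, mul_assoc]

theorem spinorForm_apply (l : ℕ) (A : MagIdx l → ℂ) (z : ℂ × ℂ) :
    spinorForm l A z = ∑ m, A m * spinorMonomial l m z := rfl

theorem MagIdx.bounds {l : ℕ} (m : MagIdx l) : -(l : ℤ) ≤ m.1 ∧ m.1 ≤ l := Finset.mem_Icc.1 m.2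

open Polynomial in
-- At `v = 1` the form becomes a polynomial in `u`, in which distinct `m` have distinct exponents `l
-- + m`.
theorem spinorForm_injective (l : ℕ) : Function.Injective (spinorForm l) := by
  rw [injective_iff_map_eq_zero]
  intro A h
  have hP : (∑ m, C (A m / spinorNorm l m) * X ^ ((l : ℤ) + m.1).toNat : ℂ[X]) = 0 := by
    refine Polynomial.funext fun x => ?_
    have := congrFun h (x, 1)
    simp only [spinorForm_apply, spinorMonomial, one_pow, mul_one, Pi.zero_apply] at this
    simp only [eval_finsetSum, eval_mul, eval_C, eval_pow, eval_X, eval_zero]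
    rw [← this]
    refine Finset.sum_congr rfl fun m _ => ?_
    ring
  ext m
  have := congrArg (fun P => coeff P ((l : ℤ) + m.1).toNat) hP
  simp only [finsetSum_coeff, coeff_C_mul, coeff_X_pow, coeff_zero] at this
  rw [Finset.sum_eq_single m] at this
  · rw [if_pos rfl, mul_one, div_eq_zero_iff] at this
    exact this.resolve_right (spinorNorm_ne_zero l m)
  · intro m' _ hm
    have h1 := m.bounds
    have h2 := m'.bounds
    rw [if_neg, mul_zero]
    intro h3
    exact hm (Subtype.ext (by omega))
  · simp

theorem ofReal_wignerSmallD (l : ℕ) (β : ℝ) (m' m : MagIdx l) :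
    (wignerSmallD l β m' m : ℂ) = spinorNorm l m' * spinorNorm l m
      * ∑ s ∈ Finset.range (2 * l + 1), (-1 : ℂ) ^ (m'.1 - m.1 + s)
      * (invFact (l + m.1 - s) : ℂ) * (invFact s : ℂ) * (invFact (m'.1 - m.1 + s) : ℂ)
      * (invFact (l - m'.1 - s) : ℂ)
      * (Real.cos (β / 2) : ℂ) ^ (2 * (l : ℤ) + m.1 - m'.1 - 2 * s).toNat
      * (Real.sin (β / 2) : ℂ) ^ (m'.1 - m.1 + 2 * s).toNat := by
  unfold wignerSmallD spinorNorm
  rw [mul_assoc (intFact (l + m'.1) * intFact (l - m'.1)),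
    Real.sqrt_mul (mul_pos (intFact_pos _) (intFact_pos _)).le]
  push_cast
  rfl

/-- The action of a rotation about the `y` axis on spinors. -/
noncomputable def spinorRotY (β : ℝ) (z : ℂ × ℂ) : ℂ × ℂ :=
  ((Real.cos (β / 2) : ℂ) * z.1 + (Real.sin (β / 2) : ℂ) * z.2,
    (Real.cos (β / 2) : ℂ) * z.2 - (Real.sin (β / 2) : ℂ) * z.1)

/-- The action of a rotation about the `z` axis on spinors. -/
noncomputable def spinorRotZ (α : ℝ) (z : ℂ × ℂ) : ℂ × ℂ :=
  (Complex.exp (-Complex.I * (α / 2)) * z.1, Complex.exp (Complex.I * (α / 2)) * z.2)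

theorem sum_wignerSmallD_mul_spinorMonomial (l : ℕ) (β : ℝ) (m : MagIdx l) (z : ℂ × ℂ) :
    ∑ m', (wignerSmallD l β m' m : ℂ) * spinorMonomial l m' z
      = spinorMonomial l m (spinorRotY β z) := by
  obtain ⟨p, hp⟩ := Int.eq_ofNat_of_zero_le (show 0 ≤ (l : ℤ) + m.1 by have := m.bounds; omega)
  obtain ⟨q, hq⟩ := Int.eq_ofNat_of_zero_le (show 0 ≤ (l : ℤ) - m.1 by have := m.bounds; omega)
  have hpq : 2 * l = p + q := by omega
  have hm : m.1 = (p : ℤ) - l := by omega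
  have hw : (spinorNorm l m : ℂ) * spinorNorm l m = p.factorial * q.factorial := by
    rw [← Complex.ofReal_mul, spinorNorm_mul_self, hp, hq, intFact_natCast, intFact_natCast]
    push_cast; rfl
  have hw0 := spinorNorm_ne_zero l m
  have key := sum_factorial_eq_mul_pow p q (Real.cos (β / 2)) (Real.sin (β / 2)) z.1 z.2
  have hR : spinorMonomial l m (spinorRotY β z) * spinorNorm l m
      = ((Real.cos (β / 2) : ℂ) * z.1 + (Real.sin (β / 2) : ℂ) * z.2) ^ p
        * ((Real.cos (β / 2) : ℂ) * z.2 - (Real.sin (β / 2) : ℂ) * z.1) ^ q := by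
    unfold spinorMonomial spinorRotY
    rw [div_mul_cancel₀ _ hw0, hp, hq]
    rfl
  refine mul_right_cancel₀ hw0 ?_
  rw [hR, ← key, Finset.sum_mul]
  -- The summand is extended to all integers so that `sum_magIdx` can reindex by the exponent `a = l
  -- + m'` of `u`.
  let F : ℤ → ℂ := fun μ => (p.factorial * q.factorial : ℂ) * ∑ k ∈ Finset.range (2 * l + 1),
        (-1 : ℂ) ^ (μ - m.1 + k)
      * (invFact (l + m.1 - k) : ℂ) * (invFact k : ℂ) * (invFact (μ - m.1 + k) : ℂ)
      * (invFact (l - μ - k) : ℂ)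
      * (Real.cos (β / 2) : ℂ) ^ (2 * (l : ℤ) + m.1 - μ - 2 * k).toNat
      * (Real.sin (β / 2) : ℂ) ^ (μ - m.1 + 2 * k).toNat
      * (z.1 ^ ((l : ℤ) + μ).toNat * z.2 ^ ((l : ℤ) - μ).toNat)
  have hF : ∀ m' : MagIdx l,
      (wignerSmallD l β m' m : ℂ) * spinorMonomial l m' z * spinorNorm l m = F m'.1 := by
    intro m'
    simp only [F]
    rw [ofReal_wignerSmallD, ← hw, ← Finset.sum_mul]
    unfold spinorMonomial
    field_simp [spinorNorm_ne_zero l m']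
  rw [Finset.sum_congr rfl fun m' _ => hF m', sum_magIdx l F, Finset.mul_sum, hpq]
  refine Finset.sum_congr rfl fun a ha => ?_
  have := Finset.mem_range.1 ha
  simp only [F, hpq]
  congr 1
  refine Finset.sum_congr rfl fun k _ => ?_
  rw [hp, show (a : ℤ) - l - m.1 = a - p by omega,
    show (l : ℤ) - (a - l) - k = p + q - a - k by omega,
    show 2 * (l : ℤ) + m.1 - (a - l) - 2 * k = p + q + p - a - 2 * k by omega,
    show (l : ℤ) + (a - l) = a by omega, show ((l : ℤ) - (a - l)).toNat = p + q - a by omega]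
  rfl

theorem spinorMonomial_spinorRotZ (l : ℕ) (α : ℝ) (m : MagIdx l) (z : ℂ × ℂ) :
    spinorMonomial l m (spinorRotZ α z)
      = Complex.exp (-Complex.I * m.1 * α) * spinorMonomial l m z := by
  obtain ⟨p, hp⟩ := Int.eq_ofNat_of_zero_le (show 0 ≤ (l : ℤ) + m.1 by have := m.bounds; omega)
  obtain ⟨q, hq⟩ := Int.eq_ofNat_of_zero_le (show 0 ≤ (l : ℤ) - m.1 by have := m.bounds; omega)
  have hm : (m.1 : ℂ) = ((p : ℂ) - q) / 2 := by
    have : 2 * m.1 = (p : ℤ) - q := by omega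
    have := congrArg (Int.cast : ℤ → ℂ) this
    push_cast at this
    rw [← this]; ring
  unfold spinorMonomial spinorRotZ
  rw [hp, hq]
  simp only [Int.toNat_natCast, mul_pow, ← Complex.exp_nat_mul]
  rw [hm, show -Complex.I * (((p : ℂ) - q) / 2) * α
    = p * (-Complex.I * (α / 2)) + q * (Complex.I * (α / 2)) by ring, Complex.exp_add]
  ring

/-- The action on spinors of the rotation with given Euler angles. -/
noncomputable def spinorRot (α β γ : ℝ) (z : ℂ × ℂ) : ℂ × ℂ :=
  spinorRotZ γ (spinorRotY β (spinorRotZ α z))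

/-- Substitution acts on the argument, so the order is reversed: in `spinorRot` the angle `α` is
applied first. -/
theorem spinorForm_wignerD (l : ℕ) (α β γ : ℝ) (A : MagIdx l → ℂ) (z : ℂ × ℂ) :
    spinorForm l (fun m => ∑ m', wignerD l α β γ m m' * A m') z
      = spinorForm l A (spinorRot α β γ z) := by
  simp only [spinorForm_apply, Finset.sum_mul, spinorRot, spinorMonomial_spinorRotZ]
  rw [Finset.sum_comm]
  refine Finset.sum_congr rfl fun m _ => ?_
  rw [← sum_wignerSmallD_mul_spinorMonomial, Finset.mul_sum, Finset.mul_sum]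
  refine Finset.sum_congr rfl fun m' _ => ?_
  rw [spinorMonomial_spinorRotZ, wignerD]
  ring

/-! ### Couplings as products of binary forms. -/

/-- The normalization of the coupling to the maximal angular momentum. -/
noncomputable def maxCouplingNorm (l₁ l₂ : ℕ) : ℝ :=
  Real.sqrt ((2 * (l₁ + l₂ : ℕ) + 1) * (2 * l₁).factorial * (2 * l₂).factorial
    / (2 * (l₁ + l₂) + 1).factorial)

theorem maxCouplingNorm_pos (l₁ l₂ : ℕ) : 0 < maxCouplingNorm l₁ l₂ := by
  unfold maxCouplingNorm
  have h : ∀ n : ℕ, (0 : ℝ) < n.factorial := fun n => by exact_mod_cast n.factorial_pos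
  have := h (2 * l₁)
  have := h (2 * l₂)
  have := h (2 * (l₁ + l₂) + 1)
  positivity

/-- For `l = l₁ + l₂` the factor `1 / (l₁ + l₂ - l - k)!` leaves only `k = 0` in Racah's sum. -/
theorem clebschGordan_max (l₁ l₂ : ℕ) (m₁ : MagIdx l₁) (m₂ : MagIdx l₂) (m : MagIdx (l₁ + l₂)) :
    clebschGordan l₁ l₂ (l₁ + l₂) m₁ m₂ m = if m.1 = m₁.1 + m₂.1 then
      maxCouplingNorm l₁ l₂ * spinorNorm _ m / (spinorNorm _ m₁ * spinorNorm _ m₂) else 0 := by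
  unfold clebschGordan
  have hc : (m.1 = m₁.1 + m₂.1 ∧ l₁ + l₂ ≤ l₁ + l₂ ∧ l₁ ≤ l₁ + l₂ + l₂ ∧ l₂ ≤ l₁ + l₂ + l₁)
      ↔ m.1 = m₁.1 + m₂.1 := ⟨fun h => h.1, fun h => ⟨h, by omega, by omega, by omega⟩⟩
  rw [if_congr hc rfl rfl]
  refine if_congr Iff.rfl ?_ rfl
  have b₁ := m₁.bounds
  have b₂ := m₂.bounds
  rw [Finset.sum_eq_single 0]
  · have i : ∀ {z : ℤ}, 0 ≤ z → invFact z = (intFact z)⁻¹ := fun h => by simp [invFact, h]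
    have hK : Real.sqrt ((2 * ((l₁ + l₂ : ℕ) : ℝ) + 1)
        * intFact (((l₁ + l₂ : ℕ) : ℤ) + l₁ - l₂) * intFact (((l₁ + l₂ : ℕ) : ℤ) - l₁ + l₂)
        * intFact ((l₁ : ℤ) + l₂ - (l₁ + l₂ : ℕ))
        / intFact ((l₁ : ℤ) + l₂ + (l₁ + l₂ : ℕ) + 1)) = maxCouplingNorm l₁ l₂ := by
      rw [show (((l₁ + l₂ : ℕ) : ℤ) + l₁ - l₂) = (2 * l₁ : ℕ) by push_cast; ring,
        show (((l₁ + l₂ : ℕ) : ℤ) - l₁ + l₂) = (2 * l₂ : ℕ) by push_cast; ring,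
        show ((l₁ : ℤ) + l₂ - (l₁ + l₂ : ℕ)) = (0 : ℕ) by push_cast; ring,
        show ((l₁ : ℤ) + l₂ + (l₁ + l₂ : ℕ) + 1) = (2 * (l₁ + l₂) + 1 : ℕ) by push_cast; ring]
      simp only [intFact_natCast, Nat.factorial_zero, Nat.cast_one, mul_one, maxCouplingNorm]
    have hN : Real.sqrt (intFact ((l₁ + l₂ : ℕ) + m.1) * intFact ((l₁ + l₂ : ℕ) - m.1)
        * intFact (l₁ - m₁.1) * intFact (l₁ + m₁.1) * intFact (l₂ - m₂.1) * intFact (l₂ + m₂.1))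
        = spinorNorm _ m * (spinorNorm _ m₁ * spinorNorm _ m₂) := by
      unfold spinorNorm
      rw [← Real.sqrt_mul (mul_pos (intFact_pos _) (intFact_pos _)).le,
        ← Real.sqrt_mul (mul_pos (intFact_pos _) (intFact_pos _)).le]
      congr 1
      ring
    rw [hK, hN, Nat.cast_zero]
    simp only [sub_zero, add_zero]
    rw [show (((l₁ + l₂ : ℕ) : ℤ) - l₂ + m₁.1) = l₁ + m₁.1 by push_cast; ring,
      show (((l₁ + l₂ : ℕ) : ℤ) - l₁ - m₂.1) = l₂ - m₂.1 by push_cast; ring,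
      show ((l₁ : ℤ) + l₂ - (l₁ + l₂ : ℕ)) = 0 by push_cast; ring,
      i le_rfl, i (by omega), i (by omega), i (by omega), i (by omega)]
    have h0 : intFact 0 = 1 := by simp [intFact]
    have s₁ := spinorNorm_mul_self l₁ m₁
    have s₂ := spinorNorm_mul_self l₂ m₂
    have p₁ := (spinorNorm_pos l₁ m₁).ne'
    have p₂ := (spinorNorm_pos l₂ m₂).ne'
    rw [h0, pow_zero, inv_one]
    calc _ = maxCouplingNorm l₁ l₂ * spinorNorm _ m * (spinorNorm _ m₁ * spinorNorm _ m₂) /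
          ((intFact (l₁ + m₁.1) * intFact (l₁ - m₁.1))
            * (intFact (l₂ + m₂.1) * intFact (l₂ - m₂.1))) := by
          simp only [div_eq_mul_inv, mul_inv]; ring
      _ = _ := by
          rw [← s₁, ← s₂]
          field_simp
  · intro k _ hk
    rw [invFact_of_neg (z := (l₁ : ℤ) + l₂ - (l₁ + l₂ : ℕ) - k) (by push_cast; omega)]
    simp
  · simp

/-- The binary form of a vector given by its components in the real basis. -/
noncomputable def harmForm (l : ℕ) : (MagIdx l → ℂ) →ₗ[ℂ] (ℂ × ℂ → ℂ) :=
  spinorForm l ∘ₗ toStandard l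

theorem harmForm_apply (l : ℕ) (A : MagIdx l → ℂ) (z : ℂ × ℂ) :
    harmForm l A z = ∑ m, toStandard l A m * spinorMonomial l m z := rfl

theorem harmForm_injective (l : ℕ) : Function.Injective (harmForm l) :=
  (spinorForm_injective l).comp (toStandard_injective l)

theorem spinorMonomial_mul (l₁ l₂ : ℕ) (m₁ : MagIdx l₁) (m₂ : MagIdx l₂) (m : MagIdx (l₁ + l₂))
    (h : m.1 = m₁.1 + m₂.1) (z : ℂ × ℂ) :
    spinorNorm _ m * spinorMonomial _ m z / (spinorNorm _ m₁ * spinorNorm _ m₂)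
      = spinorMonomial l₁ m₁ z * spinorMonomial l₂ m₂ z := by
  have b₁ := m₁.bounds
  have b₂ := m₂.bounds
  unfold spinorMonomial
  rw [mul_div_cancel₀ _ (spinorNorm_ne_zero _ m),
    show (((l₁ + l₂ : ℕ) : ℤ) + m.1).toNat = (l₁ + m₁.1).toNat + (l₂ + m₂.1).toNat by
      push_cast; omega,
    show (((l₁ + l₂ : ℕ) : ℤ) - m.1).toNat = (l₁ - m₁.1).toNat + (l₂ - m₂.1).toNat by
      push_cast; omega, pow_add, pow_add]
  simp only [div_eq_mul_inv, mul_inv]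
  ring

/-- Up to one constant, the coefficients in `clebschGordan_max` are the structure constants for
multiplying normalized monomials. -/
theorem harmForm_cgContract_max (l₁ l₂ : ℕ) (A : MagIdx l₁ → ℂ) (B : MagIdx l₂ → ℂ) :
    harmForm (l₁ + l₂) (cgContract l₁ l₂ (l₁ + l₂) A B)
      = (maxCouplingNorm l₁ l₂ : ℂ) • (harmForm l₁ A * harmForm l₂ B) := by
  ext z
  simp only [harmForm_apply, Pi.smul_apply, Pi.mul_apply, smul_eq_mul, toStandard_cgContract]
  rw [Finset.sum_mul_sum]
  simp only [Finset.sum_mul, Finset.mul_sum]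
  rw [Finset.sum_comm]
  refine Finset.sum_congr rfl fun m₁ _ => ?_
  rw [Finset.sum_comm]
  refine Finset.sum_congr rfl fun m₂ _ => ?_
  have b₁ := m₁.bounds
  have b₂ := m₂.bounds
  rw [Finset.sum_eq_single (⟨m₁.1 + m₂.1, Finset.mem_Icc.2 (by push_cast; omega)⟩ :
    MagIdx (l₁ + l₂))]
  · have h := spinorMonomial_mul l₁ l₂ m₁ m₂
      ⟨m₁.1 + m₂.1, Finset.mem_Icc.2 (by push_cast; omega)⟩ rfl z
    rw [clebschGordan_max, if_pos rfl]
    push_cast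
    linear_combination (maxCouplingNorm l₁ l₂ * toStandard l₁ A m₁ * toStandard l₂ B m₂ : ℂ) * h
  · intro m _ hm
    rw [clebschGordan_max, if_neg fun h => hm (Subtype.ext h)]
    simp
  · simp

theorem harmForm_realWignerD (l : ℕ) (α β γ : ℝ) (A : MagIdx l → ℂ) (z : ℂ × ℂ) :
    harmForm l (fun μ => ∑ μ', realWignerD l α β γ μ μ' * A μ') z
      = harmForm l A (spinorRot α β γ z) := by
  refine Eq.trans ?_ (spinorForm_wignerD l α β γ (toStandard l A) z)
  rw [harmForm_apply, spinorForm_apply]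
  simp only [toStandard_realWignerD]

theorem toStandard_vecHarm (a : Fin 3 → ℝ) :
    toStandard 1 (vecHarm a) ⟨1, by simp⟩ = (-a 0 + Complex.I * a 1) * (Real.sqrt 2 : ℂ)⁻¹ ∧
    toStandard 1 (vecHarm a) ⟨0, by simp⟩ = a 2 ∧
    toStandard 1 (vecHarm a) ⟨-1, by simp⟩ = (a 0 + Complex.I * a 1) * (Real.sqrt 2 : ℂ)⁻¹ := by
  simp only [toStandard_apply, sum_magIdx_one]
  refine ⟨?_, ?_, ?_⟩ <;> norm_num [vecHarm, realBasis] <;> ring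

theorem spinorNorm_one :
    spinorNorm 1 ⟨1, by simp⟩ = Real.sqrt 2 ∧ spinorNorm 1 ⟨0, by simp⟩ = 1 ∧
    spinorNorm 1 ⟨-1, by simp⟩ = Real.sqrt 2 := by
  refine ⟨?_, ?_, ?_⟩ <;> simp [spinorNorm, intFact]

theorem harmForm_one_apply (A : MagIdx 1 → ℂ) (z : ℂ × ℂ) :
    harmForm 1 A z = toStandard 1 A ⟨1, by simp⟩ * (Real.sqrt 2 : ℂ)⁻¹ * z.1 ^ 2
      + toStandard 1 A ⟨0, by simp⟩ * (z.1 * z.2)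
      + toStandard 1 A ⟨-1, by simp⟩ * (Real.sqrt 2 : ℂ)⁻¹ * z.2 ^ 2 := by
  obtain ⟨h₁, h₂, h₃⟩ := spinorNorm_one
  rw [harmForm_apply, sum_magIdx_one]
  simp only [spinorMonomial, h₁, h₂, h₃]
  norm_num [show Int.toNat 2 = 2 from rfl]
  ring

/-- The binary quadratic form of a vector of `ℝ³`. -/
noncomputable def vecForm (a : Fin 3 → ℝ) : ℂ × ℂ → ℂ := harmForm 1 (vecHarm a)

theorem vecForm_apply (a : Fin 3 → ℝ) (z : ℂ × ℂ) :
    vecForm a z = (-a 0 + Complex.I * a 1) / 2 * z.1 ^ 2 + a 2 * (z.1 * z.2)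
      + (a 0 + Complex.I * a 1) / 2 * z.2 ^ 2 := by
  obtain ⟨h₁, h₂, h₃⟩ := toStandard_vecHarm a
  rw [vecForm, harmForm_one_apply, h₁, h₂, h₃]
  linear_combination ((-a 0 + Complex.I * a 1) * z.1 ^ 2 + (a 0 + Complex.I * a 1) * z.2 ^ 2)
    * inv_sqrt_two_mul_self

theorem clebschGordan_one :
    clebschGordan 1 1 1 ⟨1, by simp⟩ ⟨0, by simp⟩ ⟨1, by simp⟩ = (Real.sqrt 2)⁻¹ ∧
    clebschGordan 1 1 1 ⟨0, by simp⟩ ⟨1, by simp⟩ ⟨1, by simp⟩ = -(Real.sqrt 2)⁻¹ ∧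
    clebschGordan 1 1 1 ⟨1, by simp⟩ ⟨-1, by simp⟩ ⟨0, by simp⟩ = (Real.sqrt 2)⁻¹ ∧
    clebschGordan 1 1 1 ⟨0, by simp⟩ ⟨0, by simp⟩ ⟨0, by simp⟩ = 0 ∧
    clebschGordan 1 1 1 ⟨-1, by simp⟩ ⟨1, by simp⟩ ⟨0, by simp⟩ = -(Real.sqrt 2)⁻¹ ∧
    clebschGordan 1 1 1 ⟨0, by simp⟩ ⟨-1, by simp⟩ ⟨-1, by simp⟩ = (Real.sqrt 2)⁻¹ ∧
    clebschGordan 1 1 1 ⟨-1, by simp⟩ ⟨0, by simp⟩ ⟨-1, by simp⟩ = -(Real.sqrt 2)⁻¹ := by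
  -- Racah's prefactor is `√(3 / 4!) = 1 / √8` here.
  have h : (Real.sqrt 8)⁻¹ * 2 = (Real.sqrt 2)⁻¹ := by
    rw [show (8 : ℝ) = 2 ^ 2 * 2 by norm_num, Real.sqrt_mul (by norm_num),
      Real.sqrt_sq (by norm_num)]
    field_simp
  refine ⟨?_, ?_, ?_, ?_, ?_, ?_, ?_⟩ <;>
    norm_num [clebschGordan, Finset.sum_range_succ, intFact, invFact, Nat.factorial,
      show Int.toNat 2 = 2 from rfl, show Int.toNat 4 = 4 from rfl, h]

theorem toStandard_cgContract_one (A B : MagIdx 1 → ℂ) :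
    toStandard 1 (cgContract 1 1 1 A B) ⟨1, by simp⟩ = (Real.sqrt 2 : ℂ)⁻¹
      * (toStandard 1 A ⟨1, by simp⟩ * toStandard 1 B ⟨0, by simp⟩
        - toStandard 1 A ⟨0, by simp⟩ * toStandard 1 B ⟨1, by simp⟩) ∧
    toStandard 1 (cgContract 1 1 1 A B) ⟨0, by simp⟩ = (Real.sqrt 2 : ℂ)⁻¹
      * (toStandard 1 A ⟨1, by simp⟩ * toStandard 1 B ⟨-1, by simp⟩
        - toStandard 1 A ⟨-1, by simp⟩ * toStandard 1 B ⟨1, by simp⟩) ∧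
    toStandard 1 (cgContract 1 1 1 A B) ⟨-1, by simp⟩ = (Real.sqrt 2 : ℂ)⁻¹
      * (toStandard 1 A ⟨0, by simp⟩ * toStandard 1 B ⟨-1, by simp⟩
        - toStandard 1 A ⟨-1, by simp⟩ * toStandard 1 B ⟨0, by simp⟩) := by
  have hz : ∀ m₁ m₂ m : MagIdx 1, m.1 ≠ m₁.1 + m₂.1 → clebschGordan 1 1 1 m₁ m₂ m = 0 :=
    fun m₁ m₂ m h => if_neg fun h' => h h'.1
  obtain ⟨h₁, h₂, h₃, h₄, h₅, h₆, h₇⟩ := clebschGordan_one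
  simp only [toStandard_cgContract, sum_magIdx_one, h₁, h₂, h₃, h₄, h₅, h₆, h₇]
  refine ⟨?_, ?_, ?_⟩
  · rw [hz _ _ ⟨1, _⟩, hz _ _ ⟨1, _⟩, hz _ _ ⟨1, _⟩, hz _ _ ⟨1, _⟩, hz _ _ ⟨1, _⟩,
      hz _ _ ⟨1, _⟩, hz _ _ ⟨1, _⟩] <;> norm_num
    ring
  · rw [hz _ _ ⟨0, _⟩, hz _ _ ⟨0, _⟩, hz _ _ ⟨0, _⟩, hz _ _ ⟨0, _⟩, hz _ _ ⟨0, _⟩,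
      hz _ _ ⟨0, _⟩] <;> norm_num
    ring
  · rw [hz _ _ ⟨-1, _⟩, hz _ _ ⟨-1, _⟩, hz _ _ ⟨-1, _⟩, hz _ _ ⟨-1, _⟩, hz _ _ ⟨-1, _⟩,
      hz _ _ ⟨-1, _⟩, hz _ _ ⟨-1, _⟩] <;> norm_num
    ring

/-- The contraction of two vectors to angular momentum `1` is a multiple of the cross product. -/
theorem harmForm_cgContract_one (a b : Fin 3 → ℝ) :
    harmForm 1 (cgContract 1 1 1 (vecHarm a) (vecHarm b))
      = (-Complex.I * (Real.sqrt 2 : ℂ)⁻¹) • vecForm (crossProduct a b) := by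
  ext z
  obtain ⟨h₁, h₂, h₃⟩ := toStandard_cgContract_one (vecHarm a) (vecHarm b)
  obtain ⟨a₁, a₂, a₃⟩ := toStandard_vecHarm a
  obtain ⟨b₁, b₂, b₃⟩ := toStandard_vecHarm b
  rw [harmForm_one_apply, h₁, h₂, h₃, a₁, a₂, a₃, b₁, b₂, b₃, Pi.smul_apply, vecForm_apply,
    smul_eq_mul]
  simp only [cross_apply, Matrix.cons_val]
  have hs := inv_sqrt_two_mul_self
  have hI := Complex.I_mul_I
  push_cast
  generalize (Real.sqrt 2 : ℂ)⁻¹ = s at *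
  linear_combination
    (z.1 ^ 2 * s * (a 2 * b 0 - a 0 * b 2 + Complex.I * (a 1 * b 2 - a 2 * b 1))
      - 2 * z.1 * z.2 * s * Complex.I * (a 0 * b 1 - a 1 * b 0)
      + z.2 ^ 2 * s * (a 2 * b 0 - a 0 * b 2 - Complex.I * (a 1 * b 2 - a 2 * b 1))) * hs
    + s / 2 * (a 2 * b 0 - a 0 * b 2) * (z.1 ^ 2 + z.2 ^ 2) * hI

/-- Only the first contraction contributes an imaginary factor, `-i / √2`; every later one is
maximal and contributes a positive `maxCouplingNorm`. Only that `c` is real and nonzero matters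
later. -/
theorem harmForm_pseudoMaximal (k : ℕ) : ∃ c : ℝ, c ≠ 0 ∧ ∀ v : Fin (k + 2) → Fin 3 → ℝ,
    harmForm (k + 1) (pseudoMaximal k v) = (Complex.I * c) •
      (vecForm (crossProduct (v 0) (v 1)) * ∏ j : Fin k, vecForm (v j.succ.succ)) := by
  induction k with
  | zero =>
    refine ⟨-(Real.sqrt 2)⁻¹, by simp, fun v => ?_⟩
    have := harmForm_cgContract_one (v 0) (v 1)
    simpa [pseudoMaximal] using this
  | succ k ih =>
    obtain ⟨c, hc, h⟩ := ih
    refine ⟨maxCouplingNorm (k + 1) 1 * c, mul_ne_zero (maxCouplingNorm_pos _ _).ne' hc,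
      fun v => ?_⟩
    have := harmForm_cgContract_max (k + 1) 1 (pseudoMaximal k (fun j => v j.castSucc))
      (vecHarm (v (Fin.last (k + 2))))
    refine this.trans ?_
    rw [h, Fin.prod_univ_castSucc]
    ext z
    simp only [Pi.smul_apply, Pi.mul_apply, smul_eq_mul, vecForm, Fin.castSucc_zero,
      Fin.castSucc_one, Fin.succ_last, Fin.succ_castSucc, Complex.ofReal_mul]
    ring

/-! ### Equivariance, parity and reality of the couplings. -/

/-- Spinors turn by half angles, and quadratic expressions in them recombine to the full angle. -/
theorem vecForm_rotZ (φ : ℝ) (a : Fin 3 → ℝ) (z : ℂ × ℂ) :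
    vecForm ((rotZ φ).mulVec a) z = vecForm a (spinorRotZ φ z) := by
  have h₁ : Complex.exp (-Complex.I * (φ / 2)) * Complex.exp (-Complex.I * (φ / 2))
      = Complex.cos φ - Complex.I * Complex.sin φ := by
    rw [← Complex.exp_add, show -Complex.I * (φ / 2) + -Complex.I * (φ / 2) = (-φ : ℂ) * Complex.I
      by ring, Complex.exp_mul_I, Complex.cos_neg, Complex.sin_neg]
    ring
  have h₂ : Complex.exp (Complex.I * (φ / 2)) * Complex.exp (Complex.I * (φ / 2))
      = Complex.cos φ + Complex.I * Complex.sin φ := by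
    rw [← Complex.exp_add, show Complex.I * (φ / 2) + Complex.I * (φ / 2) = (φ : ℂ) * Complex.I by
      ring, Complex.exp_mul_I]
    ring
  have h₃ : Complex.exp (-Complex.I * (φ / 2)) * Complex.exp (Complex.I * (φ / 2)) = 1 := by
    rw [← Complex.exp_add]; simp
  have hI := Complex.I_mul_I
  simp only [vecForm_apply, spinorRotZ, rotZ, Matrix.mulVec, dotProduct, Fin.sum_univ_three,
    Matrix.of_apply, Matrix.cons_val]
  push_cast
  generalize Complex.exp (-Complex.I * (φ / 2)) = e at *
  generalize Complex.exp (Complex.I * (φ / 2)) = f at *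
  linear_combination -((-a 0 + Complex.I * a 1) / 2 * z.1 ^ 2) * h₁
    - ((a 0 + Complex.I * a 1) / 2 * z.2 ^ 2) * h₂ - (a 2 * z.1 * z.2) * h₃
    + (1 / 2 * a 1 * Complex.sin φ * (z.1 ^ 2 - z.2 ^ 2)) * hI

theorem vecForm_rotY (β : ℝ) (a : Fin 3 → ℝ) (z : ℂ × ℂ) :
    vecForm ((rotY β).mulVec a) z = vecForm a (spinorRotY β z) := by
  have h₀ : (Real.cos (β / 2) : ℂ) ^ 2 + (Real.sin (β / 2) : ℂ) ^ 2 = 1 := by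
    exact_mod_cast Real.cos_sq_add_sin_sq (β / 2)
  have h₁ : (Real.cos β : ℂ) = (Real.cos (β / 2) : ℂ) ^ 2 - (Real.sin (β / 2) : ℂ) ^ 2 := by
    rw [show Real.cos β = Real.cos (2 * (β / 2)) by ring_nf, Real.cos_two_mul']
    push_cast; rfl
  have h₂ : (Real.sin β : ℂ) = 2 * (Real.sin (β / 2) : ℂ) * (Real.cos (β / 2) : ℂ) := by
    rw [show Real.sin β = Real.sin (2 * (β / 2)) by ring_nf, Real.sin_two_mul]
    push_cast; rfl
  simp only [vecForm_apply, spinorRotY, rotY, Matrix.mulVec, dotProduct, Fin.sum_univ_three,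
    Matrix.of_apply, Matrix.cons_val]
  simp only [Complex.ofReal_add, Complex.ofReal_mul, Complex.ofReal_neg, Complex.ofReal_zero,
    Complex.ofReal_one, h₁, h₂]
  generalize (Real.cos (β / 2) : ℂ) = c at *
  generalize (Real.sin (β / 2) : ℂ) = s at *
  linear_combination -(Complex.I * a 1 / 2 * (z.1 ^ 2 + z.2 ^ 2)) * h₀

theorem vecForm_eulerRot (α β γ : ℝ) (a : Fin 3 → ℝ) (z : ℂ × ℂ) :
    vecForm ((eulerRot α β γ).mulVec a) z = vecForm a (spinorRot α β γ z) := by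
  rw [eulerRot, ← Matrix.mulVec_mulVec, ← Matrix.mulVec_mulVec, vecForm_rotZ, vecForm_rotY,
    vecForm_rotZ]
  rfl

theorem crossProduct_rotZ (φ : ℝ) (a b : Fin 3 → ℝ) :
    crossProduct ((rotZ φ).mulVec a) ((rotZ φ).mulVec b)
      = (rotZ φ).mulVec (crossProduct a b) := by
  have h := Real.cos_sq_add_sin_sq φ
  ext i
  fin_cases i <;>
    simp [cross_apply, rotZ, Matrix.mulVec, dotProduct, Fin.sum_univ_three] <;>
    first | ring1 | linear_combination (a 0 * b 1 - a 1 * b 0) * h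

theorem crossProduct_rotY (φ : ℝ) (a b : Fin 3 → ℝ) :
    crossProduct ((rotY φ).mulVec a) ((rotY φ).mulVec b)
      = (rotY φ).mulVec (crossProduct a b) := by
  have h := Real.cos_sq_add_sin_sq φ
  ext i
  fin_cases i <;>
    simp [cross_apply, rotY, Matrix.mulVec, dotProduct, Fin.sum_univ_three] <;>
    first | ring1 | linear_combination (a 2 * b 0 - a 0 * b 2) * h

theorem crossProduct_eulerRot (α β γ : ℝ) (a b : Fin 3 → ℝ) :
    crossProduct ((eulerRot α β γ).mulVec a) ((eulerRot α β γ).mulVec b)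
      = (eulerRot α β γ).mulVec (crossProduct a b) := by
  simp only [eulerRot, ← Matrix.mulVec_mulVec, crossProduct_rotZ, crossProduct_rotY]

theorem vecForm_neg (a : Fin 3 → ℝ) : vecForm (-a) = -vecForm a := by
  ext z
  simp only [vecForm_apply, Pi.neg_apply]
  push_cast
  ring

theorem pseudoMaximal_eulerRot (k : ℕ) (α β γ : ℝ) (v : Fin (k + 2) → Fin 3 → ℝ)
    (μ : MagIdx (k + 1)) :
    pseudoMaximal k (fun j => (eulerRot α β γ).mulVec (v j)) μ
      = ∑ μ', realWignerD (k + 1) α β γ μ μ' * pseudoMaximal k v μ' := by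
  obtain ⟨c, -, h⟩ := harmForm_pseudoMaximal k
  refine congrFun (harmForm_injective (k + 1) (?_ : _ = harmForm (k + 1)
    (fun μ => ∑ μ', realWignerD (k + 1) α β γ μ μ' * pseudoMaximal k v μ'))) μ
  ext z
  rw [harmForm_realWignerD, h, h]
  simp only [Pi.smul_apply, Pi.mul_apply, Finset.prod_apply, crossProduct_eulerRot,
    vecForm_eulerRot]

/-- The cross product is even under inversion and the other `k` factors are odd; the sign agrees
with that of a pseudotensor, as `-(-1)^(k+1) = (-1)^k`. -/
theorem pseudoMaximal_neg (k : ℕ) (v : Fin (k + 2) → Fin 3 → ℝ) :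
    pseudoMaximal k (fun j => -v j) = (-1 : ℂ) ^ k • pseudoMaximal k v := by
  obtain ⟨c, -, h⟩ := harmForm_pseudoMaximal k
  apply harmForm_injective (k + 1)
  rw [map_smul, h, h]
  ext z
  simp [vecForm_neg, Finset.prod_neg]
  ring

/-- On forms, conjugating real-basis components is the antilinear spinor map `(u, v) ↦ (-v̄, ū)`. -/
theorem harmForm_conj (l : ℕ) (A : MagIdx l → ℂ) (z : ℂ × ℂ) :
    harmForm l (fun μ => (starRingEnd ℂ) (A μ)) z = (-1) ^ l * (starRingEnd ℂ)
      (harmForm l A (-(starRingEnd ℂ) z.2, (starRingEnd ℂ) z.1)) := by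
  rw [harmForm_apply, harmForm_apply, map_sum, Finset.mul_sum, ← sum_magIdx_neg]
  refine Finset.sum_congr rfl fun m _ => ?_
  rw [toStandard_conj, MagIdx.neg_neg, map_mul]
  unfold spinorMonomial
  rw [spinorNorm_neg, MagIdx.val_neg, sub_neg_eq_add, ← sub_eq_add_neg]
  obtain ⟨p, hp⟩ := Int.eq_ofNat_of_zero_le (show 0 ≤ (l : ℤ) + m.1 by have := m.bounds; omega)
  have hs : (-1 : ℂ) ^ (-m.1) = (-1) ^ l * (-1) ^ p := by
    rw [neg_one_zpow_neg, show m.1 = (p : ℤ) - l by omega, sub_eq_add_neg,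
      zpow_add₀ (by norm_num), neg_one_zpow_neg, zpow_natCast, zpow_natCast, mul_comm]
  rw [hs, hp]
  simp only [map_div₀, map_mul, map_pow, map_neg, Complex.conj_conj, Complex.conj_ofReal,
    Int.toNat_natCast]
  rw [neg_pow z.2 p]
  ring

theorem conj_vecForm (a : Fin 3 → ℝ) (z : ℂ × ℂ) :
    (starRingEnd ℂ) (vecForm a (-(starRingEnd ℂ) z.2, (starRingEnd ℂ) z.1)) = -vecForm a z := by
  simp only [vecForm_apply, map_add, map_mul, map_neg, map_div₀, map_pow, Complex.conj_conj,
    Complex.conj_ofReal, Complex.conj_I, map_ofNat]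
  ring

/-- The `k + 1` quadratic factors each give a sign, which cancels the `(-1)^(k+1)` of
`harmForm_conj`; only the conjugate of the prefactor `i c` remains. -/
theorem conj_pseudoMaximal (k : ℕ) (v : Fin (k + 2) → Fin 3 → ℝ) (μ : MagIdx (k + 1)) :
    (starRingEnd ℂ) (pseudoMaximal k v μ) = -pseudoMaximal k v μ := by
  obtain ⟨c, -, h⟩ := harmForm_pseudoMaximal k
  refine congrFun (harmForm_injective (k + 1) (?_ : harmForm (k + 1)
    (fun μ => (starRingEnd ℂ) (pseudoMaximal k v μ)) = harmForm (k + 1) (-pseudoMaximal k v))) μ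
  ext z
  rw [harmForm_conj, map_neg, h]
  simp only [Pi.smul_apply, Pi.neg_apply, Pi.mul_apply, Finset.prod_apply, smul_eq_mul, map_mul,
    map_prod, conj_vecForm, Complex.conj_I, Complex.conj_ofReal, Finset.prod_neg,
    Finset.card_univ, Fintype.card_fin]
  have : (-1 : ℂ) ^ k * (-1) ^ k = 1 := by rw [← mul_pow]; simp
  rw [pow_succ]
  linear_combination (-Complex.I * c * (vecForm (crossProduct (v 0) (v 1)) z
    * ∏ j : Fin k, vecForm (v j.succ.succ) z)) * this

/-! ### Euler angles for the orthogonal group. -/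

theorem exists_polar (x y : ℝ) : ∃ φ : ℝ,
    Real.sqrt (x ^ 2 + y ^ 2) * Real.cos φ = x ∧ Real.sqrt (x ^ 2 + y ^ 2) * Real.sin φ = y := by
  have h : ‖(⟨x, y⟩ : ℂ)‖ = Real.sqrt (x ^ 2 + y ^ 2) := Complex.norm_eq_sqrt_sq_add_sq _
  exact ⟨Complex.arg ⟨x, y⟩, by rw [← h, Complex.norm_mul_cos_arg],
    by rw [← h, Complex.norm_mul_sin_arg]⟩

theorem rotZ_mem (φ : ℝ) : rotZ φ ∈ Matrix.orthogonalGroup (Fin 3) ℝ := by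
  rw [Matrix.mem_orthogonalGroup_iff]
  have h := Real.cos_sq_add_sin_sq φ
  ext i j
  fin_cases i <;> fin_cases j <;>
    simp [rotZ, Matrix.mul_apply, Fin.sum_univ_three] <;>
    first | ring1 | linear_combination h

theorem rotY_mem (φ : ℝ) : rotY φ ∈ Matrix.orthogonalGroup (Fin 3) ℝ := by
  rw [Matrix.mem_orthogonalGroup_iff]
  have h := Real.cos_sq_add_sin_sq φ
  ext i j
  fin_cases i <;> fin_cases j <;>
    simp [rotY, Matrix.mul_apply, Fin.sum_univ_three] <;>
    first | ring1 | linear_combination h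

theorem det_rotZ (φ : ℝ) : (rotZ φ).det = 1 := by
  simp [rotZ, Matrix.det_fin_three]
  linear_combination Real.cos_sq_add_sin_sq φ

theorem det_rotY (φ : ℝ) : (rotY φ).det = 1 := by
  simp [rotY, Matrix.det_fin_three]
  linear_combination Real.cos_sq_add_sin_sq φ

/-- Every vector is obtained by a rotation from a multiple of the third basis vector. -/
theorem exists_rotZ_mul_rotY_mulVec (w : Fin 3 → ℝ) : ∃ α β : ℝ,
    (rotZ α * rotY β).mulVec ![0, 0, Real.sqrt (w 0 ^ 2 + w 1 ^ 2 + w 2 ^ 2)] = w := by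
  obtain ⟨α, h₁, h₂⟩ := exists_polar (w 0) (w 1)
  obtain ⟨β, h₃, h₄⟩ := exists_polar (w 2) (Real.sqrt (w 0 ^ 2 + w 1 ^ 2))
  rw [Real.sq_sqrt (by positivity), add_comm] at h₃ h₄
  refine ⟨α, β, ?_⟩
  rw [← Matrix.mulVec_mulVec]
  ext i
  fin_cases i <;>
    simp [rotZ, rotY, Matrix.mulVec, dotProduct, Fin.sum_univ_three]
  · linear_combination h₁ + Real.cos α * h₄
  · linear_combination h₂ + Real.sin α * h₄
  · linear_combination h₃

theorem exists_eq_rotZ {M : Matrix (Fin 3) (Fin 3) ℝ} (hM : M ∈ Matrix.orthogonalGroup (Fin 3) ℝ)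
    (hd : M.det = 1) (h0 : M 0 2 = 0) (h1 : M 1 2 = 0) (h2 : M 2 2 = 1) : ∃ φ, M = rotZ φ := by
  have hr := (Matrix.mem_orthogonalGroup_iff _ _).1 hM
  have hc := (Matrix.mem_orthogonalGroup_iff' _ _).1 hM
  have e := congrFun (congrFun hr 2) 2
  have e00 := congrFun (congrFun hc 0) 0
  have e01 := congrFun (congrFun hc 0) 1
  simp [Matrix.mul_apply, Fin.sum_univ_three, h2] at e e00 e01
  -- The last row has length `1` and already contains the entry `1`.
  have h20 : M 2 0 = 0 := by nlinarith [sq_nonneg (M 2 0), sq_nonneg (M 2 1)]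
  have h21 : M 2 1 = 0 := by nlinarith [sq_nonneg (M 2 0), sq_nonneg (M 2 1)]
  rw [Matrix.det_fin_three] at hd
  simp only [h0, h1, h2, h20, h21] at hd e00 e01
  obtain ⟨φ, hφ₁, hφ₂⟩ := exists_polar (M 0 0) (M 1 0)
  have hs : M 0 0 ^ 2 + M 1 0 ^ 2 = 1 := by linarith
  rw [hs, Real.sqrt_one, one_mul] at hφ₁ hφ₂
  refine ⟨φ, ?_⟩
  have h11 : M 1 1 = M 0 0 := by
    linear_combination -M 1 1 * hs + M 0 0 * hd + M 1 0 * e01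
  have h01 : M 0 1 = -M 1 0 := by
    linear_combination -M 0 1 * hs + M 0 0 * e01 - M 1 0 * hd
  ext i j
  fin_cases i <;> fin_cases j <;> simp [rotZ, *]

/-- Choose `α, β` so that `P = rotZ α * rotY β` sends the `z` axis vector to the third column of
`Q`; then `Pᵀ Q` fixes that vector, so it is a rotation about `z`. -/
theorem exists_eulerRot {Q : Matrix (Fin 3) (Fin 3) ℝ} (hQ : Q ∈ Matrix.orthogonalGroup (Fin 3) ℝ)
    (hd : Q.det = 1) : ∃ α β γ, Q = eulerRot α β γ := by
  have hc := (Matrix.mem_orthogonalGroup_iff' _ _).1 hQ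
  have e := congrFun (congrFun hc 2) 2
  simp [Matrix.mul_apply, Fin.sum_univ_three] at e
  obtain ⟨α, β, h⟩ := exists_rotZ_mul_rotY_mulVec (fun i => Q i 2)
  have hs : Q 0 2 ^ 2 + Q 1 2 ^ 2 + Q 2 2 ^ 2 = 1 := by linarith
  rw [hs, Real.sqrt_one] at h
  have hP : rotZ α * rotY β ∈ Matrix.orthogonalGroup (Fin 3) ℝ := mul_mem (rotZ_mem α) (rotY_mem β)
  have hP' := (Matrix.mem_orthogonalGroup_iff' _ _).1 hP
  set P := rotZ α * rotY β with hPdef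
  have hcol : (P.transpose * Q).mulVec ![0, 0, 1] = ![0, 0, 1] := by
    have : Q.mulVec ![0, 0, 1] = fun i => Q i 2 := by
      ext i; simp [Matrix.mulVec, dotProduct, Fin.sum_univ_three]
    rw [← Matrix.mulVec_mulVec, this, ← h, Matrix.mulVec_mulVec, hP', Matrix.one_mulVec]
  have hentry : ∀ i, (P.transpose * Q) i 2 = (![0, 0, 1] : Fin 3 → ℝ) i := fun i => by
    rw [← congrFun hcol i]
    simp [Matrix.mulVec, dotProduct, Fin.sum_univ_three]
  have hPd : P.det = 1 := by rw [hPdef, Matrix.det_mul, det_rotZ, det_rotY, one_mul]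
  obtain ⟨γ, hγ⟩ := exists_eq_rotZ (M := P.transpose * Q)
    (mul_mem (Unitary.star_mem hP) hQ)
    (by rw [Matrix.det_mul, hd, mul_one, Matrix.det_transpose,
          hPd])
    (by simpa using hentry 0) (by simpa using hentry 1) (by simpa using hentry 2)
  refine ⟨α, β, γ, ?_⟩
  rw [eulerRot, ← hγ, ← hPdef, ← mul_assoc, (Matrix.mem_orthogonalGroup_iff _ _).1 hP, one_mul]

theorem exists_eulerRot_or_neg {Q : Matrix (Fin 3) (Fin 3) ℝ}
    (hQ : Q ∈ Matrix.orthogonalGroup (Fin 3) ℝ) :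
    ∃ α β γ, Q = eulerRot α β γ ∨ Q = -eulerRot α β γ := by
  have hd : Q.det * Q.det = 1 := by
    have := congrArg Matrix.det ((Matrix.mem_orthogonalGroup_iff _ _).1 hQ)
    rwa [Matrix.det_mul, Matrix.det_transpose,
      Matrix.det_one] at this
  rcases mul_self_eq_one_iff.1 hd with h | h
  · obtain ⟨α, β, γ, e⟩ := exists_eulerRot hQ h
    exact ⟨α, β, γ, Or.inl e⟩
  · have hn : -Q ∈ Matrix.orthogonalGroup (Fin 3) ℝ := by
      rw [Matrix.mem_orthogonalGroup_iff] at hQ ⊢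
      rw [Matrix.transpose_neg, neg_mul_neg, hQ]
    obtain ⟨α, β, γ, e⟩ := exists_eulerRot hn (by rw [Matrix.det_neg, h]; norm_num)
    exact ⟨α, β, γ, Or.inr (by rw [← e, neg_neg])⟩

/-! ### Invariance of the set of coefficients. -/

/-- The real coefficients with which the value of `Θ` at `r` is expanded in pseudo-maximal
couplings. -/
def couplingCoeffs (n k : ℕ) (Θ : (Fin n → Fin 3 → ℝ) → MagIdx (k + 1) → ℝ)
    (r : Fin n → Fin 3 → ℝ) : Set ((Fin (k + 2) → Fin n) → ℝ) :=
  {c | ∀ μ, (Θ r μ : ℂ) = Complex.I * ∑ i ∈ orderedTuples n k,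
    (c i : ℂ) * pseudoMaximal k (fun j => r (i j)) μ}

theorem rotZ_zero : rotZ 0 = 1 := by
  ext i j; fin_cases i <;> fin_cases j <;> simp [rotZ]

theorem rotY_zero : rotY 0 = 1 := by
  ext i j; fin_cases i <;> fin_cases j <;> simp [rotY]

theorem spinorRotZ_zero (z : ℂ × ℂ) : spinorRotZ 0 z = z := by simp [spinorRotZ]

theorem spinorRotY_zero (z : ℂ × ℂ) : spinorRotY 0 z = z := by simp [spinorRotY]

/-- `Θ` and all couplings transform by the same linear map, so an expansion is carried along with
unchanged coefficients. -/
theorem couplingCoeffs_subset_eulerRot {n k : ℕ} {Θ : (Fin n → Fin 3 → ℝ) → MagIdx (k + 1) → ℝ}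
    (hΘ : IsHarmonicPseudotensor (k + 1) n Θ)
    (α β γ : ℝ) (r : Fin n → Fin 3 → ℝ) :
    couplingCoeffs n k Θ r
      ⊆ couplingCoeffs n k Θ (fun i => (eulerRot α β γ).mulVec (r i)) := by
  intro c hc μ
  rw [hΘ.rotation]
  simp only [pseudoMaximal_eulerRot k α β γ, hc _, Finset.mul_sum]
  rw [Finset.sum_comm]
  refine Finset.sum_congr rfl fun i _ => Finset.sum_congr rfl fun μ' _ => ?_
  ring

theorem couplingCoeffs_subset_neg {n k : ℕ} {Θ : (Fin n → Fin 3 → ℝ) → MagIdx (k + 1) → ℝ}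
    (hΘ : IsHarmonicPseudotensor (k + 1) n Θ)
    (r : Fin n → Fin 3 → ℝ) :
    couplingCoeffs n k Θ r ⊆ couplingCoeffs n k Θ (fun i => -r i) := by
  intro c hc μ
  rw [hΘ.inversion]
  simp only [pseudoMaximal_neg, Pi.smul_apply, smul_eq_mul]
  push_cast
  rw [hc μ, Finset.mul_sum, Finset.mul_sum, Finset.mul_sum]
  refine Finset.sum_congr rfl fun i _ => ?_
  ring

theorem couplingCoeffs_subset_mulVec {n k : ℕ} {Θ : (Fin n → Fin 3 → ℝ) → MagIdx (k + 1) → ℝ}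
    (hΘ : IsHarmonicPseudotensor (k + 1) n Θ)
    {Q : Matrix (Fin 3) (Fin 3) ℝ}
    (hQ : Q ∈ Matrix.orthogonalGroup (Fin 3) ℝ) (r : Fin n → Fin 3 → ℝ) :
    couplingCoeffs n k Θ r ⊆ couplingCoeffs n k Θ (fun i => Q.mulVec (r i)) := by
  obtain ⟨α, β, γ, rfl | rfl⟩ := exists_eulerRot_or_neg hQ
  · exact couplingCoeffs_subset_eulerRot hΘ α β γ r
  · refine (couplingCoeffs_subset_eulerRot hΘ α β γ r).trans ?_
    simp only [Matrix.neg_mulVec]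
    exact couplingCoeffs_subset_neg hΘ _

theorem couplingCoeffs_mulVec {n k : ℕ} {Θ : (Fin n → Fin 3 → ℝ) → MagIdx (k + 1) → ℝ}
    (hΘ : IsHarmonicPseudotensor (k + 1) n Θ)
    {Q : Matrix (Fin 3) (Fin 3) ℝ}
    (hQ : Q ∈ Matrix.orthogonalGroup (Fin 3) ℝ) (r : Fin n → Fin 3 → ℝ) :
    couplingCoeffs n k Θ (fun i => Q.mulVec (r i)) = couplingCoeffs n k Θ r := by
  refine Set.Subset.antisymm ?_ (couplingCoeffs_subset_mulVec hΘ hQ r)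
  have hQ' : Q.transpose ∈ Matrix.orthogonalGroup (Fin 3) ℝ := Unitary.star_mem hQ
  refine (couplingCoeffs_subset_mulVec hΘ hQ' _).trans (le_of_eq ?_)
  simp only [Matrix.mulVec_mulVec, (Matrix.mem_orthogonalGroup_iff' _ _).1 hQ, Matrix.one_mulVec]

/-! ### Constraints on planar and collinear configurations. -/

theorem harmForm_eulerRot {n k : ℕ} {Θ : (Fin n → Fin 3 → ℝ) → MagIdx (k + 1) → ℝ}
    (hΘ : IsHarmonicPseudotensor (k + 1) n Θ)
    (α β γ : ℝ) (r : Fin n → Fin 3 → ℝ) (z : ℂ × ℂ) :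
    harmForm (k + 1) (fun μ => (Θ (fun i => (eulerRot α β γ).mulVec (r i)) μ : ℂ)) z
      = harmForm (k + 1) (fun μ => (Θ r μ : ℂ)) (spinorRot α β γ z) := by
  rw [← harmForm_realWignerD]
  simp only [hΘ.rotation]

theorem toStandard_rotZ {n k : ℕ} {Θ : (Fin n → Fin 3 → ℝ) → MagIdx (k + 1) → ℝ}
    (hΘ : IsHarmonicPseudotensor (k + 1) n Θ)
    (α : ℝ) (r : Fin n → Fin 3 → ℝ) (m : MagIdx (k + 1)) :
    toStandard (k + 1) (fun μ => (Θ (fun i => (rotZ α).mulVec (r i)) μ : ℂ)) m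
      = Complex.exp (-Complex.I * m.1 * α) * toStandard (k + 1) (fun μ => (Θ r μ : ℂ)) m := by
  refine congrFun (spinorForm_injective (k + 1) (a₂ := fun m => Complex.exp (-Complex.I * m.1 * α)
    * toStandard (k + 1) (fun μ => (Θ r μ : ℂ)) m) ?_) m
  ext z
  have h := harmForm_eulerRot hΘ α 0 0 r z
  simp only [eulerRot, rotZ_zero, rotY_zero, mul_one, spinorRot, spinorRotZ_zero,
    spinorRotY_zero] at h
  refine h.trans ?_
  simp only [harmForm_apply, spinorForm_apply, spinorMonomial_spinorRotZ]
  refine Finset.sum_congr rfl fun m _ => ?_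
  ring

theorem inversion_coe {n k : ℕ} {Θ : (Fin n → Fin 3 → ℝ) → MagIdx (k + 1) → ℝ}
    (hΘ : IsHarmonicPseudotensor (k + 1) n Θ)
    (r : Fin n → Fin 3 → ℝ) :
    (fun μ => (Θ (fun i => -r i) μ : ℂ)) = (-1 : ℂ) ^ k • fun μ => (Θ r μ : ℂ) := by
  ext μ
  rw [hΘ.inversion]
  simp [pow_succ]

/-- At a configuration in the plane `z = 0` every other standard component vanishes. -/
theorem even_of_toStandard_ne_zero {n k : ℕ} {Θ : (Fin n → Fin 3 → ℝ) → MagIdx (k + 1) → ℝ}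
    (hΘ : IsHarmonicPseudotensor (k + 1) n Θ)
    {r : Fin n → Fin 3 → ℝ} (hr : ∀ i, r i 2 = 0)
    (m : MagIdx (k + 1)) (hm : toStandard (k + 1) (fun μ => (Θ r μ : ℂ)) m ≠ 0) :
    Even ((k : ℤ) + m.1) := by
  -- In the plane the half turn about `z` is the inversion, so a nonzero component satisfies `(-1)^k
  -- = exp(-iπm)`.
  have hrot : (fun i => (rotZ Real.pi).mulVec (r i)) = fun i => -r i := by
    ext i j
    fin_cases j <;> simp [rotZ, Matrix.mulVec, dotProduct, Fin.sum_univ_three, hr]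
  have h := toStandard_rotZ hΘ Real.pi r m
  rw [hrot, inversion_coe hΘ, map_smul, Pi.smul_apply, smul_eq_mul] at h
  have h' := mul_right_cancel₀ hm h
  rw [show -Complex.I * m.1 * Real.pi = ((-m.1 : ℤ) : ℂ) * (Real.pi * Complex.I) by
    push_cast; ring, Complex.exp_int_mul, Complex.exp_pi_mul_I, neg_one_zpow_neg] at h'
  by_contra hodd
  rw [Int.not_even_iff_odd] at hodd
  have h2 := hodd.neg_one_zpow (α := ℂ)
  rw [zpow_add₀ (by norm_num), ← h', zpow_natCast, ← mul_pow] at h2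
  norm_num at h2

/-- At a configuration on the `z` axis a harmonic pseudotensor vanishes. -/
theorem eq_zero_of_mem_axis {n k : ℕ} {Θ : (Fin n → Fin 3 → ℝ) → MagIdx (k + 1) → ℝ}
    (hΘ : IsHarmonicPseudotensor (k + 1) n Θ)
    {r : Fin n → Fin 3 → ℝ} (h0 : ∀ i, r i 0 = 0)
    (h1 : ∀ i, r i 1 = 0) : (fun μ => (Θ r μ : ℂ)) = 0 := by
  apply toStandard_injective (k + 1)
  rw [map_zero]
  have hne : ∀ m : MagIdx (k + 1), m.1 ≠ 0 →
      toStandard (k + 1) (fun μ => (Θ r μ : ℂ)) m = 0 := by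
    intro m hm
    -- This rotation fixes the axis but multiplies the component `m` by `exp(-iπ) = -1`.
    have h := toStandard_rotZ hΘ (Real.pi / m.1) r m
    have hrot : (fun i => (rotZ (Real.pi / m.1)).mulVec (r i)) = r := by
      ext i j
      fin_cases j <;> simp [rotZ, Matrix.mulVec, dotProduct, Fin.sum_univ_three, h0, h1]
    have hm' : (m.1 : ℂ) ≠ 0 := by exact_mod_cast hm
    rw [hrot, show -Complex.I * m.1 * ((Real.pi / m.1 : ℝ) : ℂ) = -(Real.pi * Complex.I) by
      push_cast; field_simp, Complex.exp_neg, Complex.exp_pi_mul_I] at h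
    norm_num at h
    exact self_eq_neg.1 h
  ext m
  by_cases hm : m.1 = 0
  · have hf : ∀ z, harmForm (k + 1) (fun μ => (Θ r μ : ℂ)) z
        = toStandard (k + 1) (fun μ => (Θ r μ : ℂ)) m * spinorMonomial (k + 1) m z := by
      intro z
      rw [harmForm_apply, Finset.sum_eq_single m]
      · intro m' _ hm'
        rw [hne m' fun h => hm' (Subtype.ext (h.trans hm.symm)), zero_mul]
      · simp
    -- On the axis the half turn about `y` is also the inversion. It multiplies `u^(k+1) v^(k+1)` by
    -- `(-1)^(k+1)`, whereas the inversion law requires `(-1)^k`.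
    have hrot : (fun i => (rotY Real.pi).mulVec (r i)) = fun i => -r i := by
      ext i j
      fin_cases j <;> simp [rotY, Matrix.mulVec, dotProduct, Fin.sum_univ_three, h0, h1]
    have h := harmForm_eulerRot hΘ 0 Real.pi 0 r (1, 1)
    simp only [eulerRot, rotZ_zero, one_mul, mul_one, spinorRot, spinorRotZ_zero] at h
    rw [hrot, inversion_coe hΘ, map_smul, Pi.smul_apply, hf, hf] at h
    simp only [spinorMonomial, spinorRotY, hm, smul_eq_mul] at h
    simp only [add_zero, sub_zero, Int.toNat_natCast, one_pow, mul_one, Real.cos_pi_div_two,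
      Real.sin_pi_div_two, Complex.ofReal_zero, Complex.ofReal_one, one_mul, zero_add,
      zero_sub] at h
    have hw := spinorNorm_ne_zero (k + 1) m
    rw [pow_succ] at h
    have h2 : (2 : ℂ) * ((-1) ^ k * (spinorNorm (k + 1) m : ℂ)⁻¹)
        * toStandard (k + 1) (fun μ => (Θ r μ : ℂ)) m = 0 := by
      linear_combination h
    simpa [hw] using h2
  · exact hne m hm

/-! ### Spans of couplings and of quadratic forms. -/

/-- The binary forms of the pseudo-maximal couplings of the given vectors. -/
noncomputable def couplingSpan (n k : ℕ) (r : Fin n → Fin 3 → ℝ) : Submodule ℂ (ℂ × ℂ → ℂ) :=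
  Submodule.span ℂ ((fun i : Fin (k + 2) → Fin n =>
    harmForm (k + 1) (pseudoMaximal k (fun j => r (i j)))) '' (orderedTuples n k : Set _))

/-- The span of the quadratic forms of the given vectors. -/
noncomputable def vecSpan {n : ℕ} (r : Fin n → Fin 3 → ℝ) : Submodule ℂ (ℂ × ℂ → ℂ) :=
  Submodule.span ℂ (Set.range fun i => vecForm (r i))

/-- The span of the quadratic forms of the cross products of the given vectors. -/
noncomputable def crossSpan {n : ℕ} (r : Fin n → Fin 3 → ℝ) : Submodule ℂ (ℂ × ℂ → ℂ) :=
  Submodule.span ℂ (Set.range fun p : Fin n × Fin n => vecForm (crossProduct (r p.1) (r p.2)))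

/-- Membership gives complex coefficients `d`. Since `Θ` and `i` times each coupling are real,
taking real parts leaves an expansion with the real coefficients `Re(-i d)`. -/
theorem couplingCoeffs_nonempty_of_mem {n k : ℕ} {Θ : (Fin n → Fin 3 → ℝ) → MagIdx (k + 1) → ℝ}
    {r : Fin n → Fin 3 → ℝ}
    (h : harmForm (k + 1) (fun μ => (Θ r μ : ℂ)) ∈ couplingSpan n k r) :
    (couplingCoeffs n k Θ r).Nonempty := by
  rw [couplingSpan, Submodule.mem_span_image_finset_iff_exists_fun] at h
  obtain ⟨c, hc⟩ := h
  simp only [← map_smul, ← map_sum] at hc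
  have hc' := harmForm_injective _ hc
  classical
  let d : (Fin (k + 2) → Fin n) → ℂ := fun i =>
    if hi : i ∈ orderedTuples n k then c ⟨i, hi⟩ else 0
  refine ⟨fun i => (-Complex.I * d i).re, fun μ => ?_⟩
  have e : (Θ r μ : ℂ) = ∑ i ∈ orderedTuples n k,
      (-Complex.I * d i) * (Complex.I * pseudoMaximal k (fun j => r (i j)) μ) := by
    rw [← congrFun hc' μ]
    refine Eq.trans ?_ (Finset.sum_coe_sort (orderedTuples n k) fun i =>
      (-Complex.I * d i) * (Complex.I * pseudoMaximal k (fun j => r (i j)) μ))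
    simp only [Finset.sum_apply, Pi.smul_apply, smul_eq_mul]
    refine Finset.sum_congr rfl fun i _ => ?_
    have : d i = c i := by simp [d]
    rw [this]
    linear_combination (c i * pseudoMaximal k (fun j => r (i.1 j)) μ) * Complex.I_mul_I
  have hre : ∀ i : Fin (k + 2) → Fin n,
      ((Complex.I * pseudoMaximal k (fun j => r (i j)) μ).re : ℂ)
        = Complex.I * pseudoMaximal k (fun j => r (i j)) μ := fun i => by
    rw [← Complex.conj_eq_iff_re, map_mul, conj_pseudoMaximal, Complex.conj_I]
    ring
  have e' := congrArg Complex.re e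
  rw [Complex.ofReal_re, Complex.re_sum] at e'
  rw [e', Finset.mul_sum, Complex.ofReal_sum]
  refine Finset.sum_congr rfl fun i _ => ?_
  rw [← hre i, Complex.re_mul_ofReal, Complex.ofReal_mul, hre i]
  ring

theorem cross_mul_prod_mem_couplingSpan {n k : ℕ} (r : Fin n → Fin 3 → ℝ) {i j : Fin n}
    (hij : j < i) (g : Fin k → Fin n) :
    vecForm (crossProduct (r i) (r j)) * ∏ a, vecForm (r (g a)) ∈ couplingSpan n k r := by
  obtain ⟨c, hc, h⟩ := harmForm_pseudoMaximal k
  -- Forms commute, so the indices may be put in the required decreasing order; `rev` reverses the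
  -- increasing order of `Tuple.sort`.
  let g' : Fin k → Fin n := fun a => g (Tuple.sort g a.rev)
  have hg' : Antitone g' := fun a b hab => Tuple.monotone_sort g (Fin.rev_le_rev.2 hab)
  let t : Fin (k + 2) → Fin n := Fin.cons i (Fin.cons j g')
  have ht : t ∈ orderedTuples n k := by
    simp only [orderedTuples, Finset.mem_filter, Finset.mem_univ, true_and]
    refine ⟨hij, fun a b ha hab => ?_⟩
    obtain ⟨a', rfl⟩ : ∃ a' : Fin k, a = a'.succ.succ :=
      ⟨⟨a.1 - 2, by omega⟩, Fin.ext (by simp; omega)⟩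
    obtain ⟨b', rfl⟩ : ∃ b' : Fin k, b = b'.succ.succ :=
      ⟨⟨b.1 - 2, by have := Fin.le_def.1 hab; omega⟩,
        Fin.ext (by have := Fin.le_def.1 hab; simp; omega)⟩
    exact hg' (by simpa using hab)
  have hprod : ∏ a, vecForm (r (g' a)) = ∏ a, vecForm (r (g a)) :=
    (Equiv.prod_comp Fin.revPerm fun a => vecForm (r (g (Tuple.sort g a)))).trans
      (Equiv.prod_comp (Tuple.sort g) fun a => vecForm (r (g a)))
  have hmem : harmForm (k + 1) (pseudoMaximal k (fun j => r (t j))) ∈ couplingSpan n k r :=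
    Submodule.subset_span ⟨t, ht, rfl⟩
  rw [h] at hmem
  have hne : Complex.I * (c : ℂ) ≠ 0 := mul_ne_zero Complex.I_ne_zero (by exact_mod_cast hc)
  have := (Submodule.smul_mem_iff _ hne).1 hmem
  rw [← hprod]
  exact this

theorem vecForm_zero : vecForm 0 = 0 := by ext z; simp [vecForm_apply]

/-- The restriction `i₀ > i₁` costs nothing, because the cross product is alternating. -/
theorem crossSpan_mul_vecSpan_pow_le {n : ℕ} (k : ℕ) (r : Fin n → Fin 3 → ℝ) :
    crossSpan r * vecSpan r ^ k ≤ couplingSpan n k r := by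
  rw [crossSpan, vecSpan, Submodule.span_pow, Submodule.span_mul_span, Submodule.span_le]
  rintro _ ⟨_, ⟨⟨i, j⟩, rfl⟩, _, hp, rfl⟩
  obtain ⟨f, rfl⟩ := Set.mem_pow.1 hp
  choose g hg using fun a => (f a).2
  simp only [List.prod_ofFn, ← hg]
  rcases lt_trichotomy j i with h | h | h
  · exact cross_mul_prod_mem_couplingSpan r h g
  · rw [h, cross_self, vecForm_zero, zero_mul]
    exact Submodule.zero_mem _
  · rw [← cross_anticomm, vecForm_neg, neg_mul]
    exact Submodule.neg_mem _ (cross_mul_prod_mem_couplingSpan r h g)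

theorem vecForm_add (a b : Fin 3 → ℝ) : vecForm (a + b) = vecForm a + vecForm b := by
  ext z; simp only [vecForm_apply, Pi.add_apply]; push_cast; ring

theorem vecForm_smul (c : ℝ) (a : Fin 3 → ℝ) : vecForm (c • a) = (c : ℂ) • vecForm a := by
  ext z; simp only [vecForm_apply, Pi.smul_apply, smul_eq_mul]; push_cast; ring

theorem vecForm_mem_vecSpan {n : ℕ} {r : Fin n → Fin 3 → ℝ} {v : Fin 3 → ℝ}
    (hv : v ∈ Submodule.span ℝ (Set.range r)) : vecForm v ∈ vecSpan r := by
  induction hv using Submodule.span_induction with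
  | mem x hx =>
    obtain ⟨i, rfl⟩ := hx
    exact Submodule.subset_span ⟨i, rfl⟩
  | zero => rw [vecForm_zero]; exact Submodule.zero_mem _
  | add x y _ _ hx hy => rw [vecForm_add]; exact Submodule.add_mem _ hx hy
  | smul c x _ hx => rw [vecForm_smul]; exact Submodule.smul_mem _ _ hx

/-- By bilinearity, coordinate vectors in the real span may replace the given vectors. -/
theorem vecForm_mem_crossSpan {n : ℕ} {r : Fin n → Fin 3 → ℝ} {v w : Fin 3 → ℝ}
    (hv : v ∈ Submodule.span ℝ (Set.range r)) (hw : w ∈ Submodule.span ℝ (Set.range r)) :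
    vecForm (crossProduct v w) ∈ crossSpan r := by
  induction hv, hw using Submodule.span_induction₂ with
  | mem_mem x y hx hy =>
    obtain ⟨i, rfl⟩ := hx
    obtain ⟨j, rfl⟩ := hy
    exact Submodule.subset_span ⟨(i, j), rfl⟩
  | zero_left y _ => rw [map_zero, LinearMap.zero_apply, vecForm_zero]; exact Submodule.zero_mem _
  | zero_right x _ => rw [map_zero, vecForm_zero]; exact Submodule.zero_mem _
  | add_left x y z _ _ _ hx hy =>
    rw [map_add, LinearMap.add_apply, vecForm_add]; exact Submodule.add_mem _ hx hy
  | add_right x y z _ _ _ hx hy => rw [map_add, vecForm_add]; exact Submodule.add_mem _ hx hy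
  | smul_left c x y _ _ h =>
    rw [map_smul, LinearMap.smul_apply, vecForm_smul]; exact Submodule.smul_mem _ _ h
  | smul_right c x y _ _ h => rw [map_smul, vecForm_smul]; exact Submodule.smul_mem _ _ h

/-- The monomial `u ^ a * v ^ b`. -/
def binaryMonomial (a b : ℕ) : ℂ × ℂ → ℂ := fun z => z.1 ^ a * z.2 ^ b

theorem binaryMonomial_mul (a b c d : ℕ) :
    binaryMonomial a b * binaryMonomial c d = binaryMonomial (a + c) (b + d) := by
  ext z; simp only [binaryMonomial, Pi.mul_apply]; ring

theorem spinorForm_mem {l : ℕ} {A : MagIdx l → ℂ} {P : Submodule ℂ (ℂ × ℂ → ℂ)}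
    (h : ∀ m : MagIdx l, A m ≠ 0 → binaryMonomial (l + m.1).toNat (l - m.1).toNat ∈ P) :
    spinorForm l A ∈ P := by
  have : spinorForm l A = ∑ m : MagIdx l, (A m / spinorNorm l m) •
      binaryMonomial (l + m.1).toNat (l - m.1).toNat := by
    ext z
    simp only [spinorForm_apply, spinorMonomial, Finset.sum_apply, Pi.smul_apply, binaryMonomial,
      smul_eq_mul]
    refine Finset.sum_congr rfl fun m _ => ?_
    ring
  rw [this]
  refine Submodule.sum_mem _ fun m _ => ?_
  by_cases hm : A m = 0
  · rw [hm, zero_div, zero_smul]; exact Submodule.zero_mem _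
  · exact Submodule.smul_mem _ _ (h m hm)

theorem binaryMonomial_mem_pow {B : Submodule ℂ (ℂ × ℂ → ℂ)} (h₁ : binaryMonomial 2 0 ∈ B)
    (h₂ : binaryMonomial 1 1 ∈ B) (h₃ : binaryMonomial 0 2 ∈ B) (l : ℕ) :
    ∀ a b : ℕ, a + b = 2 * l → binaryMonomial a b ∈ B ^ l := by
  induction l with
  | zero =>
    intro a b h
    obtain rfl : a = 0 := by omega
    obtain rfl : b = 0 := by omega
    rw [pow_zero, show binaryMonomial 0 0 = 1 by ext z; simp [binaryMonomial]]
    exact Submodule.one_le.1 le_rfl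
  | succ l ih =>
    intro a b h
    rw [pow_succ]
    by_cases ha : 2 ≤ a
    · have := Submodule.mul_mem_mul (ih (a - 2) b (by omega)) h₁
      rwa [binaryMonomial_mul, Nat.sub_add_cancel ha] at this
    by_cases hb : 2 ≤ b
    · have := Submodule.mul_mem_mul (ih a (b - 2) (by omega)) h₃
      rwa [binaryMonomial_mul, Nat.sub_add_cancel hb] at this
    · have := Submodule.mul_mem_mul (ih (a - 1) (b - 1) (by omega)) h₂
      rwa [binaryMonomial_mul, Nat.sub_add_cancel (by omega), Nat.sub_add_cancel (by omega)] at this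

theorem binaryMonomial_mem_mul_pow {A B : Submodule ℂ (ℂ × ℂ → ℂ)}
    (ha₁ : binaryMonomial 2 0 ∈ A) (ha₂ : binaryMonomial 1 1 ∈ A) (ha₃ : binaryMonomial 0 2 ∈ A)
    (h₁ : binaryMonomial 2 0 ∈ B) (h₂ : binaryMonomial 1 1 ∈ B) (h₃ : binaryMonomial 0 2 ∈ B)
    {k a b : ℕ} (h : a + b = 2 * (k + 1)) : binaryMonomial a b ∈ A * B ^ k := by
  have ih := binaryMonomial_mem_pow h₁ h₂ h₃ k
  by_cases ha : 2 ≤ a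
  · have := Submodule.mul_mem_mul ha₁ (ih (a - 2) b (by omega))
    rwa [binaryMonomial_mul, Nat.add_sub_cancel' ha, zero_add] at this
  by_cases hb : 2 ≤ b
  · have := Submodule.mul_mem_mul ha₃ (ih a (b - 2) (by omega))
    rwa [binaryMonomial_mul, Nat.add_sub_cancel' hb, zero_add] at this
  · have := Submodule.mul_mem_mul ha₂ (ih (a - 1) (b - 1) (by omega))
    rwa [binaryMonomial_mul, Nat.add_sub_cancel' (by omega), Nat.add_sub_cancel' (by omega)] at this

/-- For the planar case: `uv · (u²)^p · (v²)^q`, without using `uv ∈ B`. -/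
theorem binaryMonomial_odd_mem_mul_pow {A B : Submodule ℂ (ℂ × ℂ → ℂ)}
    (ha : binaryMonomial 1 1 ∈ A) (h₁ : binaryMonomial 2 0 ∈ B) (h₂ : binaryMonomial 0 2 ∈ B)
    {k p q : ℕ} (h : p + q = k) : binaryMonomial (2 * p + 1) (2 * q + 1) ∈ A * B ^ k := by
  have := Submodule.mul_mem_mul ha (Submodule.mul_mem_mul
    (Submodule.pow_mem_pow B h₁ p) (Submodule.pow_mem_pow B h₂ q))
  rw [← pow_add, h] at this
  convert this using 1
  ext z
  simp only [binaryMonomial, Pi.mul_apply, Pi.pow_apply]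
  ring

theorem vecForm_z : vecForm ![0, 0, 1] = binaryMonomial 1 1 := by
  ext z; simp [vecForm_apply, binaryMonomial]

theorem binaryMonomial_mem_of_vecForm_mem {B : Submodule ℂ (ℂ × ℂ → ℂ)}
    (hx : vecForm ![1, 0, 0] ∈ B) (hy : vecForm ![0, 1, 0] ∈ B) :
    binaryMonomial 2 0 ∈ B ∧ binaryMonomial 0 2 ∈ B := by
  have hI := Complex.I_mul_I
  constructor
  · have : binaryMonomial 2 0 = -vecForm ![1, 0, 0] - Complex.I • vecForm ![0, 1, 0] := by
      ext z
      simp [vecForm_apply, binaryMonomial]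
      linear_combination (z.1 ^ 2 + z.2 ^ 2) / 2 * hI
    rw [this]
    exact Submodule.sub_mem _ (Submodule.neg_mem _ hx) (Submodule.smul_mem _ _ hy)
  · have : binaryMonomial 0 2 = vecForm ![1, 0, 0] - Complex.I • vecForm ![0, 1, 0] := by
      ext z
      simp [vecForm_apply, binaryMonomial]
      linear_combination (z.1 ^ 2 + z.2 ^ 2) / 2 * hI
    rw [this]
    exact Submodule.sub_mem _ hx (Submodule.smul_mem _ _ hy)

/-! ### Existence of coefficients at every configuration. -/

/-- Here `r i` and `r j` span the `xy`-plane, which puts `uv` into `crossSpan r` and `u², v²` into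
`vecSpan r`. Whether this suffices depends on whether some vector leaves the plane. -/
theorem couplingCoeffs_nonempty_of_cross_eq {n k : ℕ}
    {Θ : (Fin n → Fin 3 → ℝ) → MagIdx (k + 1) → ℝ}
    (hΘ : IsHarmonicPseudotensor (k + 1) n Θ) {r : Fin n → Fin 3 → ℝ} {i j : Fin n} {ρ : ℝ}
    (hρ : ρ ≠ 0) (hc : crossProduct (r i) (r j) = ![0, 0, ρ]) :
    (couplingCoeffs n k Θ r).Nonempty := by
  have hc2 : r i 0 * r j 1 - r i 1 * r j 0 = ρ := by
    have := congrFun hc 2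
    simpa [cross_apply] using this
  have hi2 : r i 2 = 0 := by
    have := dot_self_cross (r i) (r j)
    rw [hc] at this
    simpa [dotProduct, Fin.sum_univ_three, hρ] using this
  have hj2 : r j 2 = 0 := by
    have := dot_cross_self (r i) (r j)
    rw [hc] at this
    simpa [dotProduct, Fin.sum_univ_three, hρ] using this
  have hri : r i ∈ Submodule.span ℝ (Set.range r) := Submodule.subset_span ⟨i, rfl⟩
  have hrj : r j ∈ Submodule.span ℝ (Set.range r) := Submodule.subset_span ⟨j, rfl⟩
  have hx : ![1, 0, 0] ∈ Submodule.span ℝ (Set.range r) := by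
    -- Cramer's rule, with `ρ` the determinant of the planar parts of `r i` and `r j`.
    have : ![1, 0, 0] = ρ⁻¹ • (r j 1 • r i - r i 1 • r j) := by
      ext a
      fin_cases a <;> simp [hi2, hj2]
      · rw [eq_comm, inv_mul_eq_iff_eq_mul₀ hρ, ← hc2]; ring
      · right; ring
    rw [this]
    exact Submodule.smul_mem _ _ (Submodule.sub_mem _ (Submodule.smul_mem _ _ hri)
      (Submodule.smul_mem _ _ hrj))
  have hy : ![0, 1, 0] ∈ Submodule.span ℝ (Set.range r) := by
    have : ![0, 1, 0] = ρ⁻¹ • (r i 0 • r j - r j 0 • r i) := by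
      ext a
      fin_cases a <;> simp [hi2, hj2]
      · right; ring
      · rw [eq_comm, inv_mul_eq_iff_eq_mul₀ hρ, ← hc2]; ring
    rw [this]
    exact Submodule.smul_mem _ _ (Submodule.sub_mem _ (Submodule.smul_mem _ _ hrj)
      (Submodule.smul_mem _ _ hri))
  have hxy : crossProduct ![1, 0, 0] ![0, 1, 0] = (![0, 0, 1] : Fin 3 → ℝ) := by
    ext a; fin_cases a <;> simp [cross_apply]
  have hA₂ : binaryMonomial 1 1 ∈ crossSpan r := by
    rw [← vecForm_z, ← hxy]
    exact vecForm_mem_crossSpan hx hy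
  obtain ⟨hB₁, hB₃⟩ := binaryMonomial_mem_of_vecForm_mem (vecForm_mem_vecSpan hx)
    (vecForm_mem_vecSpan hy)
  apply couplingCoeffs_nonempty_of_mem
  apply crossSpan_mul_vecSpan_pow_le
  refine spinorForm_mem (A := toStandard (k + 1) fun μ => (Θ r μ : ℂ)) fun m hm => ?_
  have hb := m.bounds
  by_cases h2 : ∀ a, r a 2 = 0
  · obtain ⟨s, hs⟩ := even_of_toStandard_ne_zero hΘ h2 m hm
    -- With `k + m = 2 s` the exponents `k + 1 ± m` are `2 s + 1` and `2 (k - s) + 1`.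
    have := binaryMonomial_odd_mem_mul_pow hA₂ hB₁ hB₃ (k := k) (p := s.toNat)
      (q := (k - s).toNat) (by push_cast at hb; omega)
    convert this using 2 <;> push_cast at hb ⊢ <;> omega
  -- Now the vectors span all of space, so both spans contain `u²`, `uv` and `v²`.
  · push Not at h2
    obtain ⟨a, ha⟩ := h2
    have hz : ![0, 0, 1] ∈ Submodule.span ℝ (Set.range r) := by
      have : ![0, 0, 1] = (r a 2)⁻¹ • (r a - r a 0 • ![1, 0, 0] - r a 1 • ![0, 1, 0]) := by
        ext b
        fin_cases b <;> simp [ha, Matrix.vecHead, Matrix.vecTail]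
      rw [this]
      exact Submodule.smul_mem _ _ (Submodule.sub_mem _ (Submodule.sub_mem _
        (Submodule.subset_span ⟨a, rfl⟩) (Submodule.smul_mem _ _ hx)) (Submodule.smul_mem _ _ hy))
    have hyz : crossProduct ![0, 1, 0] ![0, 0, 1] = (![1, 0, 0] : Fin 3 → ℝ) := by
      ext a; fin_cases a <;> simp [cross_apply]
    have hzx : crossProduct ![0, 0, 1] ![1, 0, 0] = (![0, 1, 0] : Fin 3 → ℝ) := by
      ext a; fin_cases a <;> simp [cross_apply]
    obtain ⟨hA₁, hA₃⟩ := binaryMonomial_mem_of_vecForm_mem (B := crossSpan r)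
      (hyz ▸ vecForm_mem_crossSpan hy hz) (hzx ▸ vecForm_mem_crossSpan hz hx)
    have hB₂ : binaryMonomial 1 1 ∈ vecSpan r := by
      rw [← vecForm_z]
      exact vecForm_mem_vecSpan hz
    exact binaryMonomial_mem_mul_pow hA₁ hA₂ hA₃ hB₁ hB₂ hB₃ (by push_cast at hb ⊢; omega)

theorem crossProduct_rotZ_mul_rotY (α β : ℝ) (a b : Fin 3 → ℝ) :
    crossProduct ((rotZ α * rotY β).mulVec a) ((rotZ α * rotY β).mulVec b)
      = (rotZ α * rotY β).mulVec (crossProduct a b) := by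
  simp only [← Matrix.mulVec_mulVec, crossProduct_rotZ, crossProduct_rotY]

theorem couplingCoeffs_nonempty {n k : ℕ} {Θ : (Fin n → Fin 3 → ℝ) → MagIdx (k + 1) → ℝ}
    (hΘ : IsHarmonicPseudotensor (k + 1) n Θ) (r : Fin n → Fin 3 → ℝ) :
    (couplingCoeffs n k Θ r).Nonempty := by
  have hax : ∀ r : Fin n → Fin 3 → ℝ, (∀ i, r i 0 = 0) → (∀ i, r i 1 = 0) →
      (couplingCoeffs n k Θ r).Nonempty := fun r h0 h1 =>
    ⟨0, fun μ => by simpa using congrFun (eq_zero_of_mem_axis hΘ h0 h1) μ⟩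
  -- Compatibility with the cross product is recorded because a reflection would introduce a sign.
  have hrot : ∀ w : Fin 3 → ℝ, w ≠ 0 → ∃ P ∈ Matrix.orthogonalGroup (Fin 3) ℝ, ∃ ρ : ℝ, ρ ≠ 0 ∧
      P.mulVec w = ![0, 0, ρ] ∧
      ∀ a b, crossProduct (P.mulVec a) (P.mulVec b) = P.mulVec (crossProduct a b) := by
    intro w hw
    obtain ⟨α, β, h⟩ := exists_rotZ_mul_rotY_mulVec w
    have hP : rotZ α * rotY β ∈ Matrix.orthogonalGroup (Fin 3) ℝ :=
      mul_mem (rotZ_mem α) (rotY_mem β)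
    have h₁ := (Matrix.mem_orthogonalGroup_iff _ _).1 hP
    have h₂ := (Matrix.mem_orthogonalGroup_iff' _ _).1 hP
    have hX := crossProduct_rotZ_mul_rotY α β
    set P := rotZ α * rotY β
    refine ⟨P.transpose, Unitary.star_mem hP, Real.sqrt (w 0 ^ 2 + w 1 ^ 2 + w 2 ^ 2), ?_, ?_, ?_⟩
    · intro h0
      rw [h0] at h
      apply hw
      rw [← h, show (![0, 0, 0] : Fin 3 → ℝ) = 0 by ext i; fin_cases i <;> rfl, Matrix.mulVec_zero]
    · conv_lhs => rw [← h]
      rw [Matrix.mulVec_mulVec, h₂, Matrix.one_mulVec]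
    · intro a b
      have := hX (P.transpose.mulVec a) (P.transpose.mulVec b)
      simp only [Matrix.mulVec_mulVec, h₁, Matrix.one_mulVec] at this
      rw [this, Matrix.mulVec_mulVec, h₂, Matrix.one_mulVec]
  by_cases hc : ∀ i j, crossProduct (r i) (r j) = 0
  · by_cases h0 : ∀ i, r i = 0
    · exact hax r (fun i => by simp [h0 i]) (fun i => by simp [h0 i])
    · push Not at h0
      obtain ⟨i, hi⟩ := h0
      obtain ⟨P, hP, ρ, hρ, hPw, hX⟩ := hrot (r i) hi
      rw [← couplingCoeffs_mulVec hΘ hP]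
      -- Once one nonzero vector lies on the `z` axis, the vanishing cross products place all the
      -- others there.
      have h : ∀ j, crossProduct ![0, 0, ρ] (P.mulVec (r j)) = 0 := fun j => by
        rw [← hPw, hX, hc, Matrix.mulVec_zero]
      refine hax _ (fun j => ?_) (fun j => ?_)
      · have := congrFun (h j) 1
        simpa [cross_apply, hρ] using this
      · have := congrFun (h j) 0
        simpa [cross_apply, hρ] using this
  · push Not at hc
    obtain ⟨i, j, hij⟩ := hc
    obtain ⟨P, hP, ρ, hρ, hPw, hX⟩ := hrot _ hij
    rw [← couplingCoeffs_mulVec hΘ hP]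
    exact couplingCoeffs_nonempty_of_cross_eq hΘ (i := i) (j := j) hρ (by rw [hX, hPw])

theorem corollary5 (n k : ℕ) (Θ : (Fin n → Fin 3 → ℝ) → MagIdx (k + 1) → ℝ)
    (hΘ : IsHarmonicPseudotensor (k + 1) n Θ) :
    ∃ f : (Fin (k + 2) → Fin n) → (Fin n → Fin 3 → ℝ) → ℝ,
      (∀ i, IsScalarFunction n (f i)) ∧
      ∀ (r : Fin n → Fin 3 → ℝ) (μ : MagIdx (k + 1)),
        (Θ r μ : ℂ) = Complex.I * ∑ i ∈ orderedTuples n k,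
          (f i r : ℂ) * pseudoMaximal k (fun j => r (i j)) μ := by
  -- The chosen family depends on `r` only through the set `couplingCoeffs n k Θ r`; equal sets
  -- along an orbit therefore give equal values.
  refine ⟨fun i r => Classical.epsilon (· ∈ couplingCoeffs n k Θ r) i, ?_, ?_⟩
  · intro i Q hQ r
    simp only [couplingCoeffs_mulVec hΘ hQ]
  · intro r μ
    exact Classical.epsilon_spec (p := (· ∈ couplingCoeffs n k Θ r))
      (couplingCoeffs_nonempty hΘ r) μ
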